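/- Let $F$ be a field of characteristic zero and let $n\ge 3$. A (right) Leibniz algebra is an $F$-vector space $L$ with a bilinear product satisfying $[[x,y],z]=[[x,z],y]+[x,[y,z]]$; let $I$ be the two-sided ideal of $L$ generated by all squares $[x,x]$. Then $[L,I]=0$, and $I$ is a right module over the Lie algebra $L/I$ via $(v,\overline{x})\mapsto[v,x]$. Let $n_{n,1}$ be the Lie algebra with basis $x_1,\dots,x_n$ and nonzero products $[x_i,x_1]=-[x_1,x_i]=x_{i+1}$ $(2\le i\le n-1)$, and let $V$ be its $n$-dimensional minimal faithful module, with basis $e_1,\dots,e_n$ and nonzero products $(e_i,x_1)=e_{i-1}$ $(2\le i\le n-1)$, $(e_n,x_j)=e_{n+1-j}$ $(2\le j\le n)$. Put $Q_{0,1}=1$, $Q_{0,k}=\frac12$ $(k\ge2)$, $Q_{1,k}=\frac{k+1}2$, and $Q_{m,k}=\dfrac{k(k+1)\cdots(k+m-2)(k+2m-1)}{2\,m!}$ $(m\ge2)$. Sums over empty ranges are zero. **Theorem.** Let $L$ be a Leibniz algebra with $L/I\cong n_{n,1}$ and such that, under this isomorphism, the module $I$ is isomorphic to $V$. Then $\dim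 L=2n$, and there are scalars $\alpha_1,\dots,\alpha_5$, $\beta_k$ $(1\le k\le n-2)$, $\gamma_{i,k}$ $(2\le i\le\lfloor\frac n2\rfloor,\ 1\le k\le n-1)$ in $F$ and a basis $\{x_1,\dots,x_n,e_1,\dots,e_n\}$ of $L$, with $e_1,\dots,e_n\in I$, whose multiplication table is as follows. (1) $[e_i,x_1]=e_{i-1}$ for $2\le i\le n-1$; $[e_n,x_j]=e_{n+1-j}$ for $2\le j\le n$; all other products with a factor $e_i$ are zero. (2) $[x_1,x_1]=\alpha_1e_{n-1}+\alpha_2e_n$; $[x_1,x_j]=-x_{j+1}$ for $2\le j\le n-1$; $[x_2,x_1]=x_3+\alpha_3e_n$; $[x_i,x_1]=x_{i+1}-\alpha_2e_{n+2-i}$ for $3\le i\le n-1$; $[x_1,x_n]=\alpha_4e_1+\alpha_2e_2$; $[x_n,x_1]=-\alpha_4e_1-2\alpha_2e_2$; $[x_2,x_n]=\alpha_5e_1+\alpha_3e_2$; $[x_i,x_n]=0$ for $3\le i\le n$. (3) $[x_2,x_2]=\sum_{k=1}^{n-2}\beta_ke_k$; $[x_{i+1},x_i]=\sum_{k=1}^{n-1}\gamma_{i,k}e_k$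 for $2\le i\le\lfloor\frac n2\rfloor$; $$[x_i,x_{i+j}]=\sum_{s=0}^{\lfloor\frac{j+1}2\rfloor}(-1)^sQ_{s,j+2-2s}\sum_{k=1}^{n-2-j+2s}\gamma_{i+s-1,\,j+1-2s+k}\,e_k\qquad(0\le j\le n-5,\ 3\le i\le\lfloor\tfrac{n+1-j}2\rfloor);$$ $$[x_2,x_j]=-(j-2)\alpha_3e_{n+2-j}+\sum_{k=1}^{n-j}\beta_{j-2+k}e_k+\sum_{s=2}^{\lfloor\frac{j+1}2\rfloor}(-1)^{s+1}Q_{s-1,j+2-2s}\sum_{k=1}^{n-2-j+2s}\gamma_{s,\,j+1-2s+k}\,e_k\qquad(3\le j\le n-1).$$ (4) For $3\le i\le\lfloor\frac{n+3}2\rfloor$, $$[x_i,x_{n+2-i}]=(-1)^i\alpha_5e_1+(-1)^i(n-1)\alpha_3e_2+\sum_{s=2}^{i-2}(-1)^{s+i}\sum_{t=1}^sQ_{s-t,n+1-2s}\sum_{k=1}^{2s-2}\gamma_{s,n+1-2s+k}e_k+\sum_{s=i-1}^{\lfloor\frac n2\rfloor}(-1)^{s+i}\sum_{t=1}^{i-2}Q_{s-t,n+1-2s}\sum_{k=1}^{2s-2}\gamma_{s,n+1-2s+k}e_k;$$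 for $4\le i\le\lfloor\frac{n+4}2\rfloor$, $$[x_i,x_{n+3-i}]=(-1)^{i+1}(i-3)(n-1)\alpha_3e_1+\sum_{s=2}^{i-3}(-1)^{s+i+1}\sum_{t=1}^s(i-2-t)Q_{s-t,n+1-2s}\sum_{k=1}^{2s-3}\gamma_{s,n+2-2s+k}e_k+\sum_{s=i-2}^{\lfloor\frac n2\rfloor}(-1)^{s+i+1}\sum_{t=1}^{i-3}(i-2-t)Q_{s-t,n+1-2s}\sum_{k=1}^{2s-3}\gamma_{s,n+2-2s+k}e_k;$$ for $4\le p\le n-1$ and $p+1\le i\le\lfloor\frac{n+p+1}2\rfloor$, $$[x_i,x_{n+p-i}]=\sum_{s=\lfloor\frac p2\rfloor+1}^{i-p}(-1)^{s+i+p}\sum_{t=1}^s\binom{i-2-t}{p-2}Q_{s-t,n+1-2s}\sum_{k=1}^{2s-p}\gamma_{s,n+p-1-2s+k}e_k+\sum_{s=\max\{i-p+1,\lfloor\frac p2\rfloor+1\}}^{\lfloor\frac n2\rfloor}(-1)^{s+i+p}\sum_{t=1}^{i-p}\binom{i-2-t}{p-2}Q_{s-t,n+1-2s}\sum_{k=1}^{2s-p}\gamma_{s,n+p-1-2s+k}e_k.$$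 (5) The remaining products $[x_i,x_j]$ are given by $[x_{i+1},x_j]=[x_{j+1},x_i]$ for $2\le i,j\le n-1$. Moreover the parameters satisfy the following linear restrictions, where $h=\lfloor\frac n2\rfloor$. (6) If $n$ is even: $$\alpha_5+\sum_{s=2}^{h}(-1)^s\gamma_{s,n+2-2s}\Big(\sum_{t=1}^sQ_{s-t,n+1-2s}\Big)-(-1)^h\tfrac12\gamma_{h,2}=0,$$ $$(n-1)\alpha_3+\sum_{s=2}^{h}(-1)^s\gamma_{s,n+3-2s}\Big(\sum_{t=1}^sQ_{s-t,n+1-2s}\Big)-(-1)^h\tfrac12\gamma_{h,3}=0,$$ $$\sum_{s=\lfloor\frac{k+3}2\rfloor}^{h}(-1)^s\gamma_{s,n+1-2s+k}\Big(\sum_{t=1}^sQ_{s-t,n+1-2s}\Big)-(-1)^h\tfrac12\gamma_{h,k+1}=0\qquad(3\le k\le n-2),$$ and, for $2\le l\le h-1$, $1\le k\le n-2l$, $$\sum_{s=\lfloor\frac{k+1}2\rfloor+l}^{h}(-1)^s\gamma_{s,n+2l-1-2s+k}\sum_{t=1}^{\min\{s,h-l\}}\Big[\tbinom{h+l-2-t}{2l-2}+\tfrac12\tbinom{h+l-2-t}{2l-3}\Big]Q_{s-t,n+1-2s}+\sum_{s=\max\{h-l+1,\lfloor\frac{k+1}2\rfloor+l\}}^{h}\tfrac12(-1)^s\gamma_{s,n+2l-1-2s+k}Q_{s-h+l-1,n+1-2s}=0.$$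 (7) If $n$ is odd: $$(h-\tfrac12)(n-1)\alpha_3+\sum_{s=2}^{h}(-1)^s\gamma_{s,n+3-2s}\sum_{t=1}^s(h-t+\tfrac12)Q_{s-t,n+1-2s}=0,$$ $$\sum_{s=\lfloor\frac{k+4}2\rfloor}^{h}(-1)^s\gamma_{s,n+2-2s+k}\sum_{t=1}^s(h-t+\tfrac12)Q_{s-t,n+1-2s}=0\qquad(2\le k\le n-4),$$ and, for $3\le l\le h$, $1\le k\le n-2l$, $$\sum_{s=\lfloor\frac k2\rfloor+l}^{h}(-1)^s\gamma_{s,n+2l-2-2s+k}\sum_{t=1}^{\min\{s,h-l+1\}}\Big[\tbinom{h+l-2-t}{2l-3}+\tfrac12\tbinom{h+l-2-t}{2l-4}\Big]Q_{s-t,n+1-2s}+\sum_{s=\max\{h-l+2,\lfloor\frac k2\rfloor+l\}}^{h}\tfrac12(-1)^s\gamma_{s,n+2l-2-2s+k}Q_{s-h+l-2,n+1-2s}=0.$$ -/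

import Mathlib

open Finset

/-- The (right) Leibniz identity `[[x, y], z] = [[x, z], y] + [x, [y, z]]` for a bilinear
product `μ x y = [x, y]`. -/
def IsLeibniz {𝕜 L : Type*} [Field 𝕜] [AddCommGroup L] [Module 𝕜 L]
    (μ : L →ₗ[𝕜] L →ₗ[𝕜] L) : Prop :=
  ∀ x y z : L, μ (μ x y) z = μ (μ x z) y + μ x (μ y z)

/-- Two-sided ideals of the algebra `(L, μ)`. -/
def IsIdeal {𝕜 L : Type*} [Field 𝕜] [AddCommGroup L] [Module 𝕜 L]
    (μ : L →ₗ[𝕜] L →ₗ[𝕜] L) (J : Submodule 𝕜 L) : Prop :=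
  ∀ x : L, ∀ v ∈ J, μ x v ∈ J ∧ μ v x ∈ J

/-- The two-sided ideal `I` generated by all squares `[x, x]`. -/
def squaresIdeal {𝕜 L : Type*} [Field 𝕜] [AddCommGroup L] [Module 𝕜 L]
    (μ : L →ₗ[𝕜] L →ₗ[𝕜] L) : Submodule 𝕜 L :=
  sInf {J | IsIdeal μ J ∧ ∀ x, μ x x ∈ J}

theorem squaresIdeal_isIdeal {𝕜 L : Type*} [Field 𝕜] [AddCommGroup L] [Module 𝕜 L]
    (μ : L →ₗ[𝕜] L →ₗ[𝕜] L) : IsIdeal μ (squaresIdeal μ) := by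
  intro x v hv
  simp only [squaresIdeal, Submodule.mem_sInf, Set.mem_ofPred_eq] at hv ⊢
  exact ⟨fun J hJ => (hJ.1 x v (hv J hJ)).1, fun J hJ => (hJ.1 x v (hv J hJ)).2⟩

/-- In a Leibniz algebra, `[L, I] = 0`. -/
theorem bracket_squaresIdeal {𝕜 L : Type*} [Field 𝕜] [AddCommGroup L] [Module 𝕜 L]
    (μ : L →ₗ[𝕜] L →ₗ[𝕜] L) (hμ : IsLeibniz μ) (x v : L) (hv : v ∈ squaresIdeal μ) :
    μ x v = 0 := by
  let J : Submodule 𝕜 L :=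
    { carrier := {v | ∀ x, μ x v = 0}
      add_mem' := fun {a b} ha hb x => by rw [map_add, ha x, hb x, add_zero]
      zero_mem' := fun x => map_zero _
      smul_mem' := fun c a ha x => by rw [map_smul, ha x, smul_zero] }
  have hJ : IsIdeal μ J := by
    intro y w hw
    have hw' : ∀ x, μ x w = 0 := hw
    refine ⟨fun x => by rw [hw' y, map_zero], fun x => ?_⟩
    have h := hμ x w y
    rw [hw' x, hw' (μ x y), zero_add, map_zero, LinearMap.zero_apply] at h
    exact h.symm
  have hsq : ∀ y, μ y y ∈ J := fun y x => by
    have h := hμ x y y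
    exact (left_eq_add.mp h)
  exact (Submodule.mem_sInf.mp hv J ⟨hJ, hsq⟩) x

/-- The product of the quotient algebra `L / I`. -/
def quotientBracket {𝕜 L : Type*} [Field 𝕜] [AddCommGroup L] [Module 𝕜 L]
    (μ : L →ₗ[𝕜] L →ₗ[𝕜] L) :
    (L ⧸ squaresIdeal μ) →ₗ[𝕜] (L ⧸ squaresIdeal μ) →ₗ[𝕜] (L ⧸ squaresIdeal μ) :=
  ((squaresIdeal μ).liftQ
    ((squaresIdeal μ).liftQ (μ.compr₂ (squaresIdeal μ).mkQ) (fun v hv => by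
      ext y
      simpa using (squaresIdeal_isIdeal μ y v hv).2)).flip
    (fun v hv => by
      ext y
      exact (Submodule.Quotient.mk_eq_zero _).mpr (squaresIdeal_isIdeal μ y v hv).1)).flip

theorem quotientBracket_mk {𝕜 L : Type*} [Field 𝕜] [AddCommGroup L] [Module 𝕜 L]
    (μ : L →ₗ[𝕜] L →ₗ[𝕜] L) (x y : L) :
    quotientBracket μ (Submodule.Quotient.mk x) (Submodule.Quotient.mk y) =
      Submodule.Quotient.mk (μ x y) := rfl

/-- The right action `I × L / I → I`, `(v, x̄) ↦ [v, x]`. -/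
def idealAction {𝕜 L : Type*} [Field 𝕜] [AddCommGroup L] [Module 𝕜 L]
    (μ : L →ₗ[𝕜] L →ₗ[𝕜] L) (hμ : IsLeibniz μ) :
    squaresIdeal μ →ₗ[𝕜] (L ⧸ squaresIdeal μ) →ₗ[𝕜] squaresIdeal μ :=
  ((squaresIdeal μ).liftQ
    (LinearMap.mk₂ 𝕜
      (fun (x : L) (v : squaresIdeal μ) =>
        (⟨μ v x, (squaresIdeal_isIdeal μ x v v.2).2⟩ : squaresIdeal μ))
      (fun x y v => Subtype.ext (by simp))
      (fun c x v => Subtype.ext (by simp))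
      (fun x v w => Subtype.ext (by simp))
      (fun c x v => Subtype.ext (by simp)))
    (fun x hx => by
      ext v
      simpa using bracket_squaresIdeal μ hμ v x hx)).flip

theorem idealAction_mk {𝕜 L : Type*} [Field 𝕜] [AddCommGroup L] [Module 𝕜 L]
    (μ : L →ₗ[𝕜] L →ₗ[𝕜] L) (hμ : IsLeibniz μ) (v : squaresIdeal μ) (x : L) :
    (idealAction μ hμ v (Submodule.Quotient.mk x) : L) = μ v x := rfl

/-- The standard basis vectors of `𝕜ⁿ`, numbered `1, …, n` (and `0` for any other number). -/
def stdVec (𝕜 : Type*) [Field 𝕜] (n k : ℕ) : Fin n → 𝕜 :=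
  fun m => if (m : ℕ) + 1 = k then 1 else 0

/-- The bilinear map on `𝕜ⁿ` that sends the pair of the `i`-th and the `j`-th basis vector to
`c i j`, for `1 ≤ i, j ≤ n`. -/
def ofTable {𝕜 : Type*} [Field 𝕜] {n : ℕ} (c : ℕ → ℕ → (Fin n → 𝕜)) :
    (Fin n → 𝕜) →ₗ[𝕜] (Fin n → 𝕜) →ₗ[𝕜] (Fin n → 𝕜) :=
  LinearMap.mk₂ 𝕜 (fun u v => ∑ i : Fin n, ∑ j : Fin n, (u i * v j) • c (i + 1) (j + 1))
    (fun u u' v => by simp [add_mul, add_smul, sum_add_distrib])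
    (fun a u v => by simp [smul_sum, smul_smul, mul_assoc])
    (fun u v v' => by simp [mul_add, add_smul, sum_add_distrib])
    (fun a u v => by simp [smul_sum, smul_smul, mul_left_comm])

theorem ofTable_stdVec {𝕜 : Type*} [Field 𝕜] {n : ℕ} (c : ℕ → ℕ → (Fin n → 𝕜)) (i j : ℕ)
    (hi : i ∈ Icc 1 n) (hj : j ∈ Icc 1 n) :
    ofTable c (stdVec 𝕜 n i) (stdVec 𝕜 n j) = c i j := by
  rw [mem_Icc] at hi hj
  obtain ⟨i, rfl⟩ := Nat.exists_eq_add_of_le' hi.1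
  obtain ⟨j, rfl⟩ := Nat.exists_eq_add_of_le' hj.1
  simp only [ofTable, LinearMap.mk₂_apply, stdVec]
  rw [sum_eq_single (⟨i, by omega⟩ : Fin n), sum_eq_single (⟨j, by omega⟩ : Fin n)]
  · simp
  · intro b _ hb
    have : (b : ℕ) ≠ j := fun h => hb (Fin.ext h)
    simp [this]
  · simp
  · intro b _ hb
    have : (b : ℕ) ≠ i := fun h => hb (Fin.ext h)
    simp [this]
  · simp

/-- The filiform Lie algebra `n_{n,1}`: on the basis `x_1, …, x_n`, the nonzero products are
`[x_i, x_1] = -[x_1, x_i] = x_{i+1}` for `2 ≤ i ≤ n - 1`. -/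
def filiformBracket (𝕜 : Type*) [Field 𝕜] (n : ℕ) :
    (Fin n → 𝕜) →ₗ[𝕜] (Fin n → 𝕜) →ₗ[𝕜] (Fin n → 𝕜) :=
  ofTable fun i j =>
    if j = 1 ∧ 2 ≤ i ∧ i < n then stdVec 𝕜 n (i + 1)
    else if i = 1 ∧ 2 ≤ j ∧ j < n then -stdVec 𝕜 n (j + 1)
    else 0

/-- The `n`-dimensional minimal faithful right module of `n_{n,1}`: on the basis
`e_1, …, e_n`, the nonzero products are `(e_i, x_1) = e_{i-1}` for `2 ≤ i ≤ n - 1` and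
`(e_n, x_j) = e_{n+1-j}` for `2 ≤ j ≤ n`. The first argument is the module element. -/
def minimalFaithfulAction (𝕜 : Type*) [Field 𝕜] (n : ℕ) :
    (Fin n → 𝕜) →ₗ[𝕜] (Fin n → 𝕜) →ₗ[𝕜] (Fin n → 𝕜) :=
  ofTable fun i j =>
    if j = 1 ∧ 2 ≤ i ∧ i < n then stdVec 𝕜 n (i - 1)
    else if i = n ∧ 2 ≤ j then stdVec 𝕜 n (n + 1 - j)
    else 0

/-- The coefficients `Q_{m,k}`, `k ≥ 1`. -/
def coeffQ (𝕜 : Type*) [Field 𝕜] : ℕ → ℕ → 𝕜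
  | 0, k => if k = 1 then 1 else 1 / 2
  | 1, k => ((k : 𝕜) + 1) / 2
  | m + 2, k =>
      (∏ r ∈ range (m + 1), ((k : 𝕜) + r)) * ((k : 𝕜) + 2 * (m + 2) - 1) /
        (2 * ((m + 2).factorial : 𝕜))

/-- The complete multiplication table on `x_1, …, x_n, e_1, …, e_n` with parameters
`α_1, …, α_5`, `β_k` (`1 ≤ k ≤ n - 2`) and `γ_{i,k}` (`2 ≤ i ≤ ⌊n/2⌋`, `1 ≤ k ≤ n - 1`). -/
structure HasTable {𝕜 L : Type*} [Field 𝕜] [AddCommGroup L] [Module 𝕜 L]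
    (μ : L →ₗ[𝕜] L →ₗ[𝕜] L) (n : ℕ) (x e : ℕ → L)
    (α β : ℕ → 𝕜) (γ : ℕ → ℕ → 𝕜) : Prop where
  /- products with a factor `e_i` -/
  e_x1 : ∀ i, 2 ≤ i → i ≤ n - 1 → μ (e i) (x 1) = e (i - 1)
  en_x : ∀ j, 2 ≤ j → j ≤ n → μ (e n) (x j) = e (n + 1 - j)
  e1_x1 : μ (e 1) (x 1) = 0
  en_x1 : μ (e n) (x 1) = 0
  e_x : ∀ i j, 1 ≤ i → i ≤ n - 1 → 2 ≤ j → j ≤ n → μ (e i) (x j) = 0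
  x_e : ∀ i j, 1 ≤ i → i ≤ n → 1 ≤ j → j ≤ n → μ (x i) (e j) = 0
  e_e : ∀ i j, 1 ≤ i → i ≤ n → 1 ≤ j → j ≤ n → μ (e i) (e j) = 0
  /- products with a factor `x_1` or with right factor `x_n` -/
  x1_x1 : μ (x 1) (x 1) = α 1 • e (n - 1) + α 2 • e n
  x1_x : ∀ j, 2 ≤ j → j ≤ n - 1 → μ (x 1) (x j) = -x (j + 1)
  x2_x1 : μ (x 2) (x 1) = x 3 + α 3 • e n
  x_x1 : ∀ i, 3 ≤ i → i ≤ n - 1 → μ (x i) (x 1) = x (i + 1) - α 2 • e (n + 2 - i)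
  x1_xn : μ (x 1) (x n) = α 4 • e 1 + α 2 • e 2
  xn_x1 : μ (x n) (x 1) = -(α 4 • e 1) - (2 * α 2) • e 2
  x2_xn : μ (x 2) (x n) = α 5 • e 1 + α 3 • e 2
  x_xn : ∀ i, 3 ≤ i → i ≤ n → μ (x i) (x n) = 0
  /- products `[x_i, x_j]` with `i + j ≤ n + 1` and `j ≥ i - 1` -/
  x2_x2 : μ (x 2) (x 2) = ∑ k ∈ Icc 1 (n - 2), β k • e k
  x_succ : ∀ i, 2 ≤ i → i ≤ n / 2 →
    μ (x (i + 1)) (x i) = ∑ k ∈ Icc 1 (n - 1), γ i k • e k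
  x_low : ∀ i j, j + 5 ≤ n → 3 ≤ i → i ≤ (n + 1 - j) / 2 →
    μ (x i) (x (i + j)) =
      ∑ s ∈ Icc 0 ((j + 1) / 2), ((-1) ^ s * coeffQ 𝕜 s (j + 2 - 2 * s)) •
        ∑ k ∈ Icc 1 (n + 2 * s - 2 - j), γ (i + s - 1) (j + 1 - 2 * s + k) • e k
  x2_x : ∀ j, 3 ≤ j → j ≤ n - 1 →
    μ (x 2) (x j) =
      -((((j : 𝕜) - 2) * α 3) • e (n + 2 - j)) +
      ∑ k ∈ Icc 1 (n - j), β (j - 2 + k) • e k +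
      ∑ s ∈ Icc 2 ((j + 1) / 2), ((-1) ^ (s + 1) * coeffQ 𝕜 (s - 1) (j + 2 - 2 * s)) •
        ∑ k ∈ Icc 1 (n + 2 * s - 2 - j), γ s (j + 1 - 2 * s + k) • e k
  /- products `[x_i, x_{n+p-i}]` with `p ≥ 2` -/
  x_high2 : ∀ i, 3 ≤ i → i ≤ (n + 3) / 2 →
    μ (x i) (x (n + 2 - i)) =
      ((-1) ^ i * α 5) • e 1 + ((-1) ^ i * ((n : 𝕜) - 1) * α 3) • e 2 +
      ∑ s ∈ Icc 2 (i - 2),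
        ((-1) ^ (s + i) * ∑ t ∈ Icc 1 s, coeffQ 𝕜 (s - t) (n + 1 - 2 * s)) •
          ∑ k ∈ Icc 1 (2 * s - 2), γ s (n + 1 - 2 * s + k) • e k +
      ∑ s ∈ Icc (i - 1) (n / 2),
        ((-1) ^ (s + i) * ∑ t ∈ Icc 1 (i - 2), coeffQ 𝕜 (s - t) (n + 1 - 2 * s)) •
          ∑ k ∈ Icc 1 (2 * s - 2), γ s (n + 1 - 2 * s + k) • e k
  x_high3 : ∀ i, 4 ≤ i → i ≤ (n + 4) / 2 →
    μ (x i) (x (n + 3 - i)) =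
      ((-1) ^ (i + 1) * ((i : 𝕜) - 3) * ((n : 𝕜) - 1) * α 3) • e 1 +
      ∑ s ∈ Icc 2 (i - 3),
        ((-1) ^ (s + i + 1) *
          ∑ t ∈ Icc 1 s, ((i : 𝕜) - 2 - t) * coeffQ 𝕜 (s - t) (n + 1 - 2 * s)) •
          ∑ k ∈ Icc 1 (2 * s - 3), γ s (n + 2 - 2 * s + k) • e k +
      ∑ s ∈ Icc (i - 2) (n / 2),
        ((-1) ^ (s + i + 1) *
          ∑ t ∈ Icc 1 (i - 3), ((i : 𝕜) - 2 - t) * coeffQ 𝕜 (s - t) (n + 1 - 2 * s)) •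
          ∑ k ∈ Icc 1 (2 * s - 3), γ s (n + 2 - 2 * s + k) • e k
  x_high : ∀ p i, 4 ≤ p → p ≤ n - 1 → p + 1 ≤ i → i ≤ (n + p + 1) / 2 →
    μ (x i) (x (n + p - i)) =
      ∑ s ∈ Icc (p / 2 + 1) (i - p),
        ((-1) ^ (s + i + p) *
          ∑ t ∈ Icc 1 s,
            ((i - 2 - t).choose (p - 2) : 𝕜) * coeffQ 𝕜 (s - t) (n + 1 - 2 * s)) •
          ∑ k ∈ Icc 1 (2 * s - p), γ s (n + p - 1 - 2 * s + k) • e k +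
      ∑ s ∈ Icc (max (i - p + 1) (p / 2 + 1)) (n / 2),
        ((-1) ^ (s + i + p) *
          ∑ t ∈ Icc 1 (i - p),
            ((i - 2 - t).choose (p - 2) : 𝕜) * coeffQ 𝕜 (s - t) (n + 1 - 2 * s)) •
          ∑ k ∈ Icc 1 (2 * s - p), γ s (n + p - 1 - 2 * s + k) • e k
  /- the remaining products `[x_i, x_j]`, with `j < i - 1`, reduce to those above -/
  x_symm : ∀ i j, 2 ≤ i → i ≤ n - 1 → 2 ≤ j → j ≤ n - 1 →
    μ (x (i + 1)) (x j) = μ (x (j + 1)) (x i)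

/-- The linear restrictions on the parameters for even `n`. -/
structure EvenRestrictions {𝕜 : Type*} [Field 𝕜] (n : ℕ) (α : ℕ → 𝕜) (γ : ℕ → ℕ → 𝕜) :
    Prop where
  r1 : α 5 +
      ∑ s ∈ Icc 2 (n / 2),
        (-1) ^ s * γ s (n + 2 - 2 * s) * ∑ t ∈ Icc 1 s, coeffQ 𝕜 (s - t) (n + 1 - 2 * s) -
      (-1) ^ (n / 2) * (1 / 2) * γ (n / 2) 2 = 0
  r2 : ((n : 𝕜) - 1) * α 3 +
      ∑ s ∈ Icc 2 (n / 2),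
        (-1) ^ s * γ s (n + 3 - 2 * s) * ∑ t ∈ Icc 1 s, coeffQ 𝕜 (s - t) (n + 1 - 2 * s) -
      (-1) ^ (n / 2) * (1 / 2) * γ (n / 2) 3 = 0
  r3 : ∀ k, 3 ≤ k → k ≤ n - 2 →
      ∑ s ∈ Icc ((k + 3) / 2) (n / 2),
        (-1) ^ s * γ s (n + 1 - 2 * s + k) *
          ∑ t ∈ Icc 1 s, coeffQ 𝕜 (s - t) (n + 1 - 2 * s) -
      (-1) ^ (n / 2) * (1 / 2) * γ (n / 2) (k + 1) = 0
  r4 : ∀ l k, 2 ≤ l → l ≤ n / 2 - 1 → 1 ≤ k → k ≤ n - 2 * l →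
      ∑ s ∈ Icc ((k + 1) / 2 + l) (n / 2),
        (-1) ^ s * γ s (n + 2 * l - 1 - 2 * s + k) *
          ∑ t ∈ Icc 1 (min s (n / 2 - l)),
            (((n / 2 + l - 2 - t).choose (2 * l - 2) : 𝕜) +
              1 / 2 * ((n / 2 + l - 2 - t).choose (2 * l - 3) : 𝕜)) *
              coeffQ 𝕜 (s - t) (n + 1 - 2 * s) +
      ∑ s ∈ Icc (max (n / 2 - l + 1) ((k + 1) / 2 + l)) (n / 2),
        1 / 2 * (-1) ^ s * γ s (n + 2 * l - 1 - 2 * s + k) *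
          coeffQ 𝕜 (s + l - 1 - n / 2) (n + 1 - 2 * s) = 0

/-- The linear restrictions on the parameters for odd `n`. -/
structure OddRestrictions {𝕜 : Type*} [Field 𝕜] (n : ℕ) (α : ℕ → 𝕜) (γ : ℕ → ℕ → 𝕜) :
    Prop where
  r1 : (((n / 2 : ℕ) : 𝕜) - 1 / 2) * ((n : 𝕜) - 1) * α 3 +
      ∑ s ∈ Icc 2 (n / 2),
        (-1) ^ s * γ s (n + 3 - 2 * s) *
          ∑ t ∈ Icc 1 s,
            (((n / 2 : ℕ) : 𝕜) - t + 1 / 2) * coeffQ 𝕜 (s - t) (n + 1 - 2 * s) = 0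
  r2 : ∀ k, 2 ≤ k → k ≤ n - 4 →
      ∑ s ∈ Icc ((k + 4) / 2) (n / 2),
        (-1) ^ s * γ s (n + 2 - 2 * s + k) *
          ∑ t ∈ Icc 1 s,
            (((n / 2 : ℕ) : 𝕜) - t + 1 / 2) * coeffQ 𝕜 (s - t) (n + 1 - 2 * s) = 0
  r3 : ∀ l k, 3 ≤ l → l ≤ n / 2 → 1 ≤ k → k ≤ n - 2 * l →
      ∑ s ∈ Icc (k / 2 + l) (n / 2),
        (-1) ^ s * γ s (n + 2 * l - 2 - 2 * s + k) *
          ∑ t ∈ Icc 1 (min s (n / 2 - l + 1)),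
            (((n / 2 + l - 2 - t).choose (2 * l - 3) : 𝕜) +
              1 / 2 * ((n / 2 + l - 2 - t).choose (2 * l - 4) : 𝕜)) *
              coeffQ 𝕜 (s - t) (n + 1 - 2 * s) +
      ∑ s ∈ Icc (max (n / 2 - l + 2) (k / 2 + l)) (n / 2),
        1 / 2 * (-1) ^ s * γ s (n + 2 * l - 2 - 2 * s + k) *
          coeffQ 𝕜 (s + l - 2 - n / 2) (n + 1 - 2 * s) = 0

/-!
Write `c i j = [x i, x j]` for lifts `x i` of the basis of the filiform quotient. For `i, j ≥ 2`
these products lie in `I`, and the whole algebra is determined by them and by the products with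
`x 1`.

*Normalization* (`exists_isNormalized`). Adding elements of `I` to `x 1` and `x 2` removes all
components of `[x 1, x 1]`, `[x 2, x 1] + [x 1, x 2]` and `[x 2, x 2]` that can be removed, because
`x 1` acts on `e 1, …, e (n - 1)` as a nilpotent shift `D` and `[e n, x 2] = e (n - 1)`. The other
generators are defined by `x (j + 1) = -[x 1, x j]`.

*Reduction to a shift array* (`IsNormalized.isShiftArray`). The Leibniz identity with `x 1` in the
last place gives `c i (j + 1) + c (i + 1) j = D (c i j)` up to a correction in the row `i = 2`;
with `x 1` in the first place it gives the symmetry `c (i + 1) j = c (j + 1) i` and, together with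
the former, `c i n = 0` for `i ≥ 3`; with all indices at least `2` it shows that `c i j` has no
component along `e n`. So `d i j = c (i + 1) j` is a symmetric array of sequences with
`d i (j + 1) + d (i + 1) j = D (d i j)` and almost vanishing last column. The row `c 2 j` fits in
as the row `d 1 j`: formally `d 1 1` is a sequence with `D (d 1 1) = 2 [x 2, x 2]`. This makes
sense because on sequences of coordinates the shift is surjective, although `D` is not surjective
on the span of `e 1, …, e (n - 1)`.

*Solution of the recursion.* By symmetry `2 d a (a + 1) = D (d a a)`, and moving away from the
diagonal expresses all `d i j` with `i + j ≤ n` through the diagonal sequences `γ s = d s s`. The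
coefficients satisfy the recursion `Q_{m+1,k+1} = Q_{m+1,k} + Q_{m,k+1}` (`coeffQ_succ_succ`),
whence `IsShiftArray.apply_eq_sum_diag`. On the antidiagonals above `i + j = n` one starts instead
from the last column and moves towards the diagonal; each step sums the previous antidiagonal with
alternating signs, and Pascal's rule produces the binomial coefficients
(`IsShiftArray.apply_high`).

*Restrictions.* Above `i + j = n` the entries `d a a` and `d a (a + 1)` are thus both computed
from the last column (or, for `n = 2 a`, `d a a` is `γ a` itself), and `2 d a (a + 1) = D (d a a)`
becomes a linear relation between the `γ s` and the corner sequence `d 1 n`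
(`IsShiftArray.relation_of_even`, `IsShiftArray.relation_of_add_succ_eq`).
-/

/-! ### The coefficients `Q_{m,k}` -/

section Coefficients

variable {𝕜 : Type*} [Field 𝕜]

theorem coeffQ_zero_one : coeffQ 𝕜 0 1 = 1 := by simp [coeffQ]

theorem coeffQ_zero_add_two (k : ℕ) : coeffQ 𝕜 0 (k + 2) = 1 / 2 := by simp [coeffQ]

theorem coeffQ_one_right [CharZero 𝕜] (m : ℕ) : coeffQ 𝕜 m 1 = 1 := by
  match m with
  | 0 => simp [coeffQ]
  | 1 => norm_num [coeffQ]
  | m + 2 =>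
    have h : ∏ r ∈ range (m + 1), (((1 : ℕ) : 𝕜) + r) = ((m + 1).factorial : 𝕜) := by
      rw [← prod_range_add_one_eq_factorial]
      push_cast
      exact prod_congr rfl fun r _ => add_comm _ _
    have h1 : ((m + 1).factorial : 𝕜) ≠ 0 := Nat.cast_ne_zero.mpr (Nat.factorial_ne_zero _)
    have h2 : (m : 𝕜) + 2 ≠ 0 := by exact_mod_cast Nat.succ_ne_zero (m + 1)
    rw [coeffQ, h, Nat.factorial_succ (m + 1)]
    push_cast
    rw [show (m : 𝕜) + 1 + 1 = m + 2 by ring]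
    field_simp
    ring

/-- The Pascal-type recursion `Q_{m+1,k+1} = Q_{m+1,k} + Q_{m,k+1}`, for `k ≥ 1`. -/
theorem coeffQ_succ_succ [CharZero 𝕜] (m k : ℕ) :
    coeffQ 𝕜 (m + 1) (k + 2) = coeffQ 𝕜 (m + 1) (k + 1) + coeffQ 𝕜 m (k + 2) := by
  match m with
  | 0 => simp [coeffQ]; ring
  | 1 => simp [coeffQ]; field_simp; norm_num [Nat.factorial]; ring
  | m + 2 =>
    have h1 : ((m + 2).factorial : 𝕜) ≠ 0 := Nat.cast_ne_zero.mpr (Nat.factorial_ne_zero _)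
    have h2 : (m : 𝕜) + 3 ≠ 0 := by exact_mod_cast Nat.succ_ne_zero (m + 2)
    have hR : ∏ r ∈ range (m + 1), (((k + 1 : ℕ) : 𝕜) + ((r + 1 : ℕ) : 𝕜)) =
        ∏ r ∈ range (m + 1), (((k + 2 : ℕ) : 𝕜) + r) :=
      prod_congr rfl fun r _ => by push_cast; ring
    rw [show m + 2 + 1 = (m + 1) + 2 from rfl, coeffQ, coeffQ, coeffQ,
      prod_range_succ _ (m + 1), prod_range_succ' _ (m + 1), hR,
      show m + 1 + 2 = (m + 2) + 1 from rfl, Nat.factorial_succ (m + 2)]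
    push_cast
    rw [show (m : 𝕜) + 2 + 1 = m + 3 by ring]
    field_simp
    ring

/-- The signed coefficient with which `γ_{a+s}` enters the entry in position `(a, a + l)`. -/
def diagWeight (𝕜 : Type*) [Field 𝕜] (l s : ℕ) : 𝕜 :=
  if 2 * s ≤ l then (-1) ^ s * coeffQ 𝕜 s (l + 1 - 2 * s) else 0

theorem diagWeight_add_two_zero (l : ℕ) :
    diagWeight 𝕜 (l + 2) 0 = diagWeight 𝕜 (l + 1) 0 := by
  simp [diagWeight, coeffQ]

theorem diagWeight_add_two_succ [CharZero 𝕜] (l s : ℕ) :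
    diagWeight 𝕜 (l + 2) (s + 1) = diagWeight 𝕜 (l + 1) (s + 1) - diagWeight 𝕜 l s := by
  unfold diagWeight
  rcases lt_trichotomy (2 * s) l with h | h | h
  · obtain ⟨k, rfl⟩ : ∃ k, l = 2 * s + k + 1 := ⟨l - 2 * s - 1, by omega⟩
    rw [if_pos (by omega), if_pos (by omega), if_pos (by omega),
      show 2 * s + k + 1 + 2 + 1 - 2 * (s + 1) = k + 2 by omega,
      show 2 * s + k + 1 + 1 + 1 - 2 * (s + 1) = k + 1 by omega,
      show 2 * s + k + 1 + 1 - 2 * s = k + 2 by omega, coeffQ_succ_succ]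
    ring
  · subst h
    rw [if_pos (by omega), if_neg (by omega), if_pos (by omega),
      show 2 * s + 2 + 1 - 2 * (s + 1) = 1 by omega, show 2 * s + 1 - 2 * s = 1 by omega,
      coeffQ_one_right, coeffQ_one_right]
    ring
  · rw [if_neg (by omega), if_neg (by omega), if_neg (by omega), sub_zero]

/-- The binomial coefficient `(a - 1 - t).choose q`, cut off to `0` for `t > a - 1 - q`. The
cut-off matters only for `q = 0`, where the truncated subtraction would otherwise give `1`. -/
def cutChoose (q a t : ℕ) : ℕ := if t + q + 1 ≤ a then (a - 1 - t).choose q else 0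

theorem cutChoose_of_le {q a t : ℕ} (h : t + q + 1 ≤ a) :
    cutChoose q a t = (a - 1 - t).choose q := if_pos h

theorem cutChoose_of_lt {q a t : ℕ} (h : a < t + q + 1) : cutChoose q a t = 0 :=
  if_neg (not_le.mpr h)

theorem cutChoose_succ_succ (q a t : ℕ) :
    cutChoose (q + 1) (a + 1) t = cutChoose (q + 1) a t + cutChoose q a t := by
  unfold cutChoose
  rcases lt_trichotomy (t + q + 1) a with h | h | h
  · obtain ⟨b, rfl⟩ : ∃ b, a = t + q + 1 + b + 1 := ⟨a - (t + q + 1) - 1, by omega⟩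
    rw [if_pos (by omega), if_pos (by omega), if_pos (by omega),
      show t + q + 1 + b + 1 + 1 - 1 - t = (q + b + 1) + 1 by omega,
      show t + q + 1 + b + 1 - 1 - t = q + b + 1 by omega, Nat.choose_succ_succ, add_comm]
  · subst h
    rw [if_pos (by omega), if_neg (by omega), if_pos (by omega),
      show t + q + 1 + 1 - 1 - t = q + 1 by omega, show t + q + 1 - 1 - t = q by omega]
    simp
  · rw [if_neg (by omega), if_neg (by omega), if_neg (by omega)]

theorem cutChoose_zero_succ (a t : ℕ) :
    cutChoose 0 (a + 1) t = cutChoose 0 a t + if t = a then 1 else 0 := by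
  unfold cutChoose
  rcases lt_trichotomy t a with h | h | h
  · rw [if_pos (by omega), if_pos (by omega), if_neg (by omega)]; simp
  · rw [if_pos (by omega), if_neg (by omega), if_pos h]; simp
  · rw [if_neg (by omega), if_neg (by omega), if_neg (by omega)]

end Coefficients

/-! ### Symmetric arrays compatible with the shift -/

/-- A symmetric array of sequences `f i j = (f i j k)_{k ≥ 1}`, `1 ≤ i, j ≤ n`, on which the sum of
the two index shifts `i ↦ i + 1`, `j ↦ j + 1` acts as the shift of sequences, whose last column
vanishes except for its first entry, and whose diagonal sequences end before `k = n`. -/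
structure IsShiftArray {𝕜 : Type*} [Field 𝕜] (n : ℕ) (f : ℕ → ℕ → ℕ → 𝕜) : Prop where
  symm : ∀ i j k, 1 ≤ i → i ≤ n → 1 ≤ j → j ≤ n → f i j k = f j i k
  shift : ∀ i j k, 1 ≤ i → i < n → 1 ≤ j → j < n → 1 ≤ k →
    f i (j + 1) k + f (i + 1) j k = f i j (k + 1)
  last : ∀ i k, 2 ≤ i → i ≤ n → f i n k = 0
  diag_eq_zero : ∀ i k, 1 ≤ i → i ≤ n → n ≤ k → f i i k = 0

namespace IsShiftArray

variable {𝕜 : Type*} [Field 𝕜] {n : ℕ} {f : ℕ → ℕ → ℕ → 𝕜}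

/-- By symmetry, the entry next to the diagonal is half of the shift of the diagonal entry. -/
theorem two_mul_superdiag (hf : IsShiftArray n f) {a k : ℕ} (ha : 1 ≤ a) (han : a < n)
    (hk : 1 ≤ k) : 2 * f a (a + 1) k = f a a (k + 1) := by
  rw [← hf.shift a a k ha han ha han hk, hf.symm (a + 1) a k (by omega) (by omega) ha han.le]
  ring

/-- The expansion along the diagonal, with a summation range of any sufficient length `N`: padding
by zero weights spares the induction on `l` a case distinction on its parity. -/
theorem apply_eq_sum_diagWeight [CharZero 𝕜] (hf : IsShiftArray n f) (l : ℕ) :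
    ∀ N a k, l < 2 * N → 1 ≤ a → a + l ≤ n → 1 ≤ k →
      f a (a + l) k =
        ∑ s ∈ range N, diagWeight 𝕜 l s * f (a + s) (a + s) (l - 2 * s + k) := by
  induction l using Nat.strong_induction_on with
  | _ l ih =>
    intro N a k hN ha hal hk
    obtain ⟨N, rfl⟩ : ∃ M, N = M + 1 := ⟨N - 1, by omega⟩
    match l, ih, hN, hal with
    | 0, _, _, _ =>
      rw [sum_range_succ', sum_eq_zero]
      · simp [diagWeight, coeffQ]
      · intro s _
        simp [diagWeight]
    | 1, _, _, hal =>
      rw [sum_range_succ', sum_eq_zero]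
      · have h := hf.two_mul_superdiag ha (by omega : a < n) hk
        simp only [diagWeight, coeffQ, add_zero, add_comm 1 k, mul_zero, tsub_zero]
        rw [← h]
        simp
      · intro s _
        simp [diagWeight, show ¬ 2 * (s + 1) ≤ 1 by omega]
    | l + 2, ih, hN, hal =>
      -- `f a (a + l + 2) = D (f a (a + l + 1)) - f (a + 1) (a + 1 + l)`
      have h := hf.shift a (a + (l + 1)) k ha (by omega) (by omega) (by omega) hk
      have e1 := ih (l + 1) (by omega) (N + 1) a (k + 1) (by omega) ha (by omega) (by omega)
      have e2 := ih l (by omega) N (a + 1) k (by omega) (by omega) (by omega) hk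
      rw [show a + 1 + l = a + (l + 1) by ring] at e2
      rw [e1, e2] at h
      rw [show a + (l + 2) = a + (l + 1) + 1 by ring, eq_sub_of_add_eq h, sum_range_succ',
        sum_range_succ', diagWeight_add_two_zero, add_sub_right_comm, ← sum_sub_distrib]
      congr 1
      · refine sum_congr rfl fun s _ => ?_
        rw [diagWeight_add_two_succ, show l + 2 - 2 * (s + 1) + k = l - 2 * s + k by omega,
          sub_mul, show a + 1 + s = a + (s + 1) by ring]
        congr 1
        by_cases hs : 2 * (s + 1) ≤ l + 1
        · rw [show l + 1 - 2 * (s + 1) + (k + 1) = l - 2 * s + k by omega]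
        · simp [diagWeight, hs]
      · rw [show l + 1 - 2 * 0 + (k + 1) = l + 2 - 2 * 0 + k by omega]

/-- Every entry is a combination of shifts of the diagonal entries. -/
theorem apply_eq_sum_diag [CharZero 𝕜] (hf : IsShiftArray n f) {a l k : ℕ} (ha : 1 ≤ a)
    (hal : a + l ≤ n) (hk : 1 ≤ k) :
    f a (a + l) k = ∑ s ∈ range (l / 2 + 1),
      (-1) ^ s * coeffQ 𝕜 s (l + 1 - 2 * s) * f (a + s) (a + s) (l - 2 * s + k) := by
  rw [hf.apply_eq_sum_diagWeight l (l / 2 + 1) a k (by omega) ha hal hk]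
  refine sum_congr rfl fun s hs => ?_
  rw [diagWeight, if_pos (by have := mem_range.mp hs; omega)]

/-- The weight with which, up to sign, `f s s` enters the entries `f a j` with
`a + j = n + q + 1`. -/
def highWeight (𝕜 : Type*) [Field 𝕜] (n q a s : ℕ) : 𝕜 :=
  ∑ t ∈ Icc 1 s, (cutChoose q a t : 𝕜) * coeffQ 𝕜 (s - t) (n + 1 - 2 * s)

theorem highWeight_succ_succ (q a s : ℕ) :
    highWeight 𝕜 n (q + 1) (a + 1) s = highWeight 𝕜 n (q + 1) a s + highWeight 𝕜 n q a s := by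
  simp only [highWeight, ← sum_add_distrib, cutChoose_succ_succ, Nat.cast_add, add_mul]

theorem highWeight_zero_succ {a : ℕ} (ha : 1 ≤ a) (s : ℕ) :
    highWeight 𝕜 n 0 (a + 1) s =
      highWeight 𝕜 n 0 a s + if a ≤ s then coeffQ 𝕜 (s - a) (n + 1 - 2 * s) else 0 := by
  have h : (if a ≤ s then coeffQ 𝕜 (s - a) (n + 1 - 2 * s) else 0) =
      ∑ t ∈ Icc 1 s, if t = a then coeffQ 𝕜 (s - t) (n + 1 - 2 * s) else 0 := by
    rw [sum_ite_eq']
    simp [ha]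
  rw [h, highWeight, highWeight, ← sum_add_distrib]
  refine sum_congr rfl fun t _ => ?_
  rw [cutChoose_zero_succ a t]
  split_ifs <;> push_cast <;> ring

theorem highWeight_self (q s : ℕ) : highWeight 𝕜 n q (q + 1) s = 0 := by
  refine sum_eq_zero fun t ht => ?_
  rw [cutChoose_of_lt (by have := mem_Icc.mp ht; omega)]
  simp

/-- The antidiagonal `i + j = n`, as a combination of the diagonal sequences. -/
theorem apply_antidiag [CharZero 𝕜] (hf : IsShiftArray n f) {a j k : ℕ} (ha : 1 ≤ a) (haj : a ≤ j)
    (hn : a + j = n) (hk : 1 ≤ k) :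
    f a j k = ∑ s ∈ Icc 1 (n / 2), (-1) ^ (a + s) *
      (if a ≤ s then coeffQ 𝕜 (s - a) (n + 1 - 2 * s) else 0) * f s s (n - 2 * s + k) := by
  obtain ⟨l, rfl⟩ := Nat.exists_eq_add_of_le haj
  have h : Icc a (n / 2) ⊆ Icc 1 (n / 2) := Icc_subset_Icc_left ha
  rw [hf.apply_eq_sum_diag ha (by omega) hk, ← sum_subset h, ← Ico_add_one_right_eq_Icc a,
    sum_Ico_eq_sum_range, show n / 2 + 1 - a = l / 2 + 1 by omega]
  · refine sum_congr rfl fun s _ => ?_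
    rw [if_pos (by omega), show a + s - a = s by omega,
      show n + 1 - 2 * (a + s) = l + 1 - 2 * s by omega,
      show n - 2 * (a + s) = l - 2 * s by omega,
      show a + (a + s) = 2 * a + s by ring, pow_add, pow_mul]
    simp
  · intro s hs hs'
    rw [if_neg (by simp only [mem_Icc] at hs hs'; omega)]
    simp

/-- Above the antidiagonal `i + j = n`, the entries are determined by the diagonal sequences and
by the corner sequence `f 1 n`: every antidiagonal is computed from its entry in the
last column by `f (a + 1) j = D (f a j) - f a (j + 1)`. -/
theorem apply_high [CharZero 𝕜] (hf : IsShiftArray n f) (q : ℕ) :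
    ∀ a j k, a + j = n + q + 1 → q + 1 ≤ a → a ≤ j → 1 ≤ k →
      f a j k = (-1) ^ (a + q + 1) * ((a - 2).choose q : 𝕜) * f 1 n (q + k) +
        ∑ s ∈ Icc 1 (n / 2), (-1) ^ (a + q + 1 + s) * highWeight 𝕜 n q a s *
          f s s (n + q + 1 - 2 * s + k) := by
  induction q with
  | zero =>
    intro a j k hj ha
    induction a, ha using Nat.le_induction generalizing j k with
    | base =>
      intro _ _
      obtain rfl : j = n := by omega
      simp [highWeight_self 0]
    | succ a ha ih =>
      intro haj hk
      have h := hf.shift a j k (by omega) (by omega) (by omega) (by omega) hk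
      rw [ih (j + 1) k (by omega) (by omega) hk,
        hf.apply_antidiag (by omega) (by omega) (by omega : a + j = n) (by omega)] at h
      rw [eq_sub_of_add_eq' h, sub_add_eq_sub_sub, sub_right_comm, ← sum_sub_distrib,
        sub_eq_neg_add]
      congr 1
      · simp [pow_succ]
      · refine sum_congr rfl fun s hs => ?_
        rw [highWeight_zero_succ (by omega),
          show n - 2 * s + (k + 1) = n + 0 + 1 - 2 * s + k by
            have := mem_Icc.mp hs; omega]
        ring
  | succ q ihq =>
    intro a j k hj ha
    induction a, ha using Nat.le_induction generalizing j k with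
    | base =>
      intro _ _
      obtain rfl : j = n := by omega
      rw [hf.last _ _ (by omega) (by omega), Nat.choose_eq_zero_of_lt (by omega)]
      simp [highWeight_self (q + 1)]
    | succ a ha ih =>
      intro haj hk
      have h := hf.shift a j k (by omega) (by omega) (by omega) (by omega) hk
      rw [ih (j + 1) k (by omega) (by omega) hk,
        ihq a j (k + 1) (by omega) (by omega) (by omega) (by omega)] at h
      rw [eq_sub_of_add_eq' h, add_sub_add_comm, ← sum_sub_distrib,
        show a + 1 - 2 = (a - 2) + 1 by omega, Nat.choose_succ_succ]
      congr 1
      · rw [show q + (k + 1) = q + 1 + k by ring]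
        push_cast
        ring
      · refine sum_congr rfl fun s hs => ?_
        rw [highWeight_succ_succ, show n + q + 1 - 2 * s + (k + 1) = n + (q + 1) + 1 - 2 * s + k by
          have := mem_Icc.mp hs; omega]
        ring

end IsShiftArray

/-! ### Relations among the diagonal sequences -/

section Weights

variable {𝕜 : Type*} [Field 𝕜]

theorem sum_Icc_one_ite_le {M : Type*} [AddCommMonoid M] (s A : ℕ) (F : ℕ → M) :
    ∑ t ∈ Icc 1 s, (if t ≤ A then F t else 0) = ∑ t ∈ Icc 1 (min s A), F t := by
  rw [← sum_filter]
  congr 1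
  ext t
  simp only [mem_filter, mem_Icc]
  omega

/-- The weights without the cut-off convention. -/
theorem highWeight_eq_sum {n q a : ℕ} (h : q + 1 ≤ a) (s : ℕ) :
    IsShiftArray.highWeight 𝕜 n q a s = ∑ t ∈ Icc 1 (min s (a - q - 1)),
      ((a - 1 - t).choose q : 𝕜) * coeffQ 𝕜 (s - t) (n + 1 - 2 * s) := by
  rw [← sum_Icc_one_ite_le, IsShiftArray.highWeight]
  refine sum_congr rfl fun t _ => ?_
  split_ifs with ht
  · rw [cutChoose_of_le (by omega)]
  · rw [cutChoose_of_lt (by omega)]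
    simp

theorem highWeight_add_half {n q a : ℕ} (h : q + 2 ≤ a) (s : ℕ) :
    IsShiftArray.highWeight 𝕜 n (q + 1) a s + 1 / 2 * IsShiftArray.highWeight 𝕜 n q a s =
      ∑ t ∈ Icc 1 (min s (a - q - 2)),
        (((a - 1 - t).choose (q + 1) : 𝕜) + 1 / 2 * ((a - 1 - t).choose q : 𝕜)) *
          coeffQ 𝕜 (s - t) (n + 1 - 2 * s) +
      if a - q - 1 ≤ s then 1 / 2 * coeffQ 𝕜 (s - (a - q - 1)) (n + 1 - 2 * s) else 0 := by
  have h1 : (if a - q - 1 ≤ s then 1 / 2 * coeffQ 𝕜 (s - (a - q - 1)) (n + 1 - 2 * s) else 0) =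
      ∑ t ∈ Icc 1 s, if t = a - q - 1 then 1 / 2 * coeffQ 𝕜 (s - t) (n + 1 - 2 * s) else 0 := by
    rw [sum_ite_eq']
    simp [show 1 ≤ a - q - 1 by omega]
  rw [h1, ← sum_Icc_one_ite_le, ← sum_add_distrib, IsShiftArray.highWeight,
    IsShiftArray.highWeight, mul_sum, ← sum_add_distrib]
  refine sum_congr rfl fun t _ => ?_
  rcases lt_trichotomy t (a - q - 1) with ht | ht | ht
  · rw [cutChoose_of_le (by omega), cutChoose_of_le (by omega), if_pos (by omega),
      if_neg (by omega)]
    ring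
  · rw [cutChoose_of_lt (by omega), cutChoose_of_le (by omega), if_neg (by omega), if_pos ht,
      show a - 1 - t = q by omega]
    simp
  · rw [cutChoose_of_lt (by omega), cutChoose_of_lt (by omega), if_neg (by omega),
      if_neg (by omega)]
    simp

end Weights

namespace IsShiftArray

variable {𝕜 : Type*} [Field 𝕜] {n : ℕ} {f : ℕ → ℕ → ℕ → 𝕜}

/-- Terms of a sum over the diagonal sequences vanish where these sequences have ended. -/
theorem sum_diag_eq_sum_diag (hf : IsShiftArray n f) {lo lo' : ℕ} {w : ℕ → 𝕜} {m : ℕ → ℕ}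
    (h1 : 1 ≤ lo) (hlo : lo ≤ lo') (hm : ∀ s, lo ≤ s → s < lo' → s ≤ n / 2 → n ≤ m s) :
    ∑ s ∈ Icc lo (n / 2), w s * f s s (m s) = ∑ s ∈ Icc lo' (n / 2), w s * f s s (m s) := by
  refine (sum_subset (Icc_subset_Icc_left hlo) fun s hs hs' => ?_).symm
  simp only [mem_Icc] at hs hs'
  rw [hf.diag_eq_zero s _ (by omega) (by omega) (hm s hs.1 (by omega) hs.2), mul_zero]

/-- The comparison of `f h (h + 1)` with `f h h` on the first antidiagonal above `i + j = n`. -/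
theorem relation_of_even [CharZero 𝕜] (hf : IsShiftArray n f) {h k : ℕ} (hn : n = 2 * h)
    (hh : 1 ≤ h) (hk : 1 ≤ k) :
    f 1 n k + ∑ s ∈ Icc 1 (n / 2),
        ((-1) ^ s * ∑ t ∈ Icc 1 s, coeffQ 𝕜 (s - t) (n + 1 - 2 * s)) * f s s (n + 1 - 2 * s + k) -
      (-1) ^ h * (1 / 2) * f h h (k + 1) = 0 := by
  have e := hf.two_mul_superdiag hh (by omega : h < n) hk
  rw [hf.apply_high 0 h (h + 1) k (by omega) (by omega) (by omega) hk] at e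
  have hsum : ∑ s ∈ Icc 1 (n / 2),
      ((-1) ^ s * ∑ t ∈ Icc 1 s, coeffQ 𝕜 (s - t) (n + 1 - 2 * s)) * f s s (n + 1 - 2 * s + k) =
      ∑ s ∈ Icc 1 (n / 2), (-1) ^ s * highWeight 𝕜 n 0 h s * f s s (n + 1 - 2 * s + k) +
        (-1) ^ h * f h h (k + 1) := by
    have h2 : (-1) ^ h * f h h (k + 1) =
        ∑ s ∈ Icc 1 (n / 2), if s = h then (-1) ^ s * f s s (n + 1 - 2 * s + k) else 0 := by
      rw [sum_ite_eq', if_pos (by simp only [mem_Icc]; omega),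
        show n + 1 - 2 * h + k = k + 1 by omega]
    rw [h2, ← sum_add_distrib]
    refine sum_congr rfl fun s hs => ?_
    rw [mem_Icc] at hs
    -- the full sum over `t ≤ s` is the weight for `a = h + 1`, which differs from that for
    -- `a = h` only at `s = t = h`
    have h3 : ∑ t ∈ Icc 1 s, coeffQ 𝕜 (s - t) (n + 1 - 2 * s) = highWeight 𝕜 n 0 (h + 1) s := by
      rw [highWeight_eq_sum (by omega), min_eq_left (by omega)]
      simp
    rw [h3, highWeight_zero_succ hh]
    rcases eq_or_ne s h with rfl | hne
    · simp [show n + 1 - 2 * s = 1 by omega, coeffQ_zero_one]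
      ring
    · rw [if_neg (by omega), if_neg hne]
      simp
  have hsgn : ((-1 : 𝕜) ^ h) * (-1) ^ h = 1 := by rw [← mul_pow]; simp
  have h4 : ∑ s ∈ Icc 1 (n / 2), (-1) ^ (h + 0 + 1 + s) * highWeight 𝕜 n 0 h s *
        f s s (n + 0 + 1 - 2 * s + k) = -((-1) ^ h *
      ∑ s ∈ Icc 1 (n / 2), (-1) ^ s * highWeight 𝕜 n 0 h s * f s s (n + 1 - 2 * s + k)) := by
    rw [mul_sum, ← sum_neg_distrib]
    refine sum_congr rfl fun s _ => ?_
    rw [add_zero n]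
    ring
  rw [h4] at e
  rw [hsum, ← e]
  simp only [Nat.choose_zero_right, zero_add, add_zero, pow_succ]
  push_cast
  linear_combination (-f 1 n k -
    ∑ s ∈ Icc 1 (n / 2), (-1) ^ s * highWeight 𝕜 n 0 h s * f s s (n + 1 - 2 * s + k)) * hsgn

/-- The comparison of `f a (a + 1)` with `f a a` on the higher antidiagonals. -/
theorem relation_of_add_succ_eq [CharZero 𝕜] (hf : IsShiftArray n f) {q a k : ℕ}
    (hn : n + q + 1 = 2 * a) (hq : q + 2 ≤ a) (han : a < n) (hk : 1 ≤ k) :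
    (((a - 2).choose (q + 1) : 𝕜) + 1 / 2 * ((a - 2).choose q : 𝕜)) * f 1 n (q + 1 + k) +
      ∑ s ∈ Icc 1 (n / 2),
        ((-1) ^ s * (highWeight 𝕜 n (q + 1) a s + 1 / 2 * highWeight 𝕜 n q a s)) *
          f s s (n + q + 2 - 2 * s + k) = 0 := by
  have e := hf.two_mul_superdiag (by omega : 1 ≤ a) han hk
  rw [hf.apply_high (q + 1) a (a + 1) k (by omega) (by omega) (by omega) hk,
    hf.apply_high q a a (k + 1) (by omega) (by omega) le_rfl (by omega)] at e
  have h4 (q' m : ℕ) (g : ℕ → 𝕜) : ∑ s ∈ Icc 1 (n / 2),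
      (-1) ^ (m + s) * highWeight 𝕜 n q' a s * g s = (-1) ^ m *
      ∑ s ∈ Icc 1 (n / 2), (-1) ^ s * highWeight 𝕜 n q' a s * g s := by
    rw [mul_sum]
    exact sum_congr rfl fun s _ => by ring
  have h5 : ∑ s ∈ Icc 1 (n / 2), (-1) ^ s * highWeight 𝕜 n q a s *
      f s s (n + q + 1 - 2 * s + (k + 1)) = ∑ s ∈ Icc 1 (n / 2), (-1) ^ s * highWeight 𝕜 n q a s *
      f s s (n + q + 2 - 2 * s + k) := by
    refine sum_congr rfl fun s hs => ?_
    rw [show n + q + 1 - 2 * s + (k + 1) = n + q + 2 - 2 * s + k by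
      have := mem_Icc.mp hs; omega]
  have h6 : ∑ s ∈ Icc 1 (n / 2),
        ((-1) ^ s * (highWeight 𝕜 n (q + 1) a s + 1 / 2 * highWeight 𝕜 n q a s)) *
          f s s (n + q + 2 - 2 * s + k) =
      ∑ s ∈ Icc 1 (n / 2), (-1) ^ s * highWeight 𝕜 n (q + 1) a s * f s s (n + q + 2 - 2 * s + k) +
      1 / 2 * ∑ s ∈ Icc 1 (n / 2), (-1) ^ s * highWeight 𝕜 n q a s *
        f s s (n + q + 2 - 2 * s + k) := by
    rw [mul_sum, ← sum_add_distrib]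
    exact sum_congr rfl fun s _ => by ring
  rw [h4, h4, h5, show n + (q + 1) + 1 = n + q + 2 by ring, show q + (k + 1) = q + 1 + k by ring]
    at e
  rw [h6]
  have hsgn : ((-1 : 𝕜) ^ (a + q)) * (-1) ^ (a + q) = 1 := by rw [← mul_pow]; simp
  simp only [pow_succ, ← add_assoc] at e
  set S1 := ∑ s ∈ Icc 1 (n / 2), (-1) ^ s * highWeight 𝕜 n (q + 1) a s *
    f s s (n + q + 2 - 2 * s + k)
  set S2 := ∑ s ∈ Icc 1 (n / 2), (-1) ^ s * highWeight 𝕜 n q a s * f s s (n + q + 2 - 2 * s + k)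
  set c1 := ((a - 2).choose (q + 1) : 𝕜)
  set c2 := ((a - 2).choose q : 𝕜)
  linear_combination (1 / 2 * (-1) ^ (a + q)) * e -
    ((c1 + 1 / 2 * c2) * f 1 n (q + 1 + k) + (S1 + 1 / 2 * S2)) * hsgn

/-- For even `n` the antidiagonals with a pair `(a, a + 1)` above `i + j = n` are those with
`n + q + 2 = 2 a + 1`, so `q` is odd, apart from the first one. -/
theorem evenRestrictions [CharZero 𝕜] (hf : IsShiftArray n f) {α : ℕ → 𝕜} (hn : 3 ≤ n)
    (he : Even n) (h1 : f 1 n 1 = α 5) (h2 : f 1 n 2 = ((n : 𝕜) - 1) * α 3)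
    (h3 : ∀ k, 3 ≤ k → f 1 n k = 0) : EvenRestrictions n α fun s k => f s s k := by
  obtain ⟨h, rfl⟩ := he.two_dvd
  have key (k lo : ℕ) (hk : 1 ≤ k) (h1 : 1 ≤ lo) (hlo : 2 * lo ≤ k + 3) :
      f 1 (2 * h) k + ∑ s ∈ Icc lo (2 * h / 2),
        (-1) ^ s * f s s (2 * h + 1 - 2 * s + k) *
          (∑ t ∈ Icc 1 s, coeffQ 𝕜 (s - t) (2 * h + 1 - 2 * s)) -
      (-1) ^ (2 * h / 2) * (1 / 2) * f (2 * h / 2) (2 * h / 2) (k + 1) = 0 := by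
    have := hf.relation_of_even rfl (by omega) hk
    rw [hf.sum_diag_eq_sum_diag le_rfl h1 (by omega)] at this
    rw [← this, show 2 * h / 2 = h by omega]
    simp only [mul_right_comm]
  refine ⟨?_, ?_, fun k hk hkn => ?_, fun l k hl hlh hk hkn => ?_⟩
  · rw [← key 1 2 le_rfl (by norm_num) (by norm_num), h1]
    congr 2
    refine sum_congr rfl fun s hs => ?_
    rw [show 2 * h + 2 - 2 * s = 2 * h + 1 - 2 * s + 1 by have := mem_Icc.mp hs; omega]
  · rw [← key 2 2 (by norm_num) (by norm_num) (by norm_num), h2]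
    congr 2
    refine sum_congr rfl fun s hs => ?_
    rw [show 2 * h + 3 - 2 * s = 2 * h + 1 - 2 * s + 2 by have := mem_Icc.mp hs; omega]
  · rw [← key k ((k + 3) / 2) (by omega) (by omega) (by omega), h3 k hk, zero_add]
  · obtain ⟨l, rfl⟩ := Nat.exists_eq_add_of_le' hl
    have e := hf.relation_of_add_succ_eq (q := 2 * l + 1) (a := h + l + 1) (k := k) (by omega)
      (by omega) (by omega) hk
    rw [h3 _ (by omega), mul_zero, zero_add,
      hf.sum_diag_eq_sum_diag le_rfl (by omega : 1 ≤ (k + 1) / 2 + (l + 2)) (by omega)] at e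
    have hI : Icc (max (2 * h / 2 - (l + 2) + 1) ((k + 1) / 2 + (l + 2))) (2 * h / 2) =
        (Icc ((k + 1) / 2 + (l + 2)) (2 * h / 2)).filter
          fun s => h + l + 1 - (2 * l + 1) - 1 ≤ s := by
      ext s
      simp only [mem_filter, mem_Icc]
      omega
    rw [hI, sum_filter, ← sum_add_distrib]
    refine Eq.trans (sum_congr rfl fun s hs => ?_) e
    rw [mem_Icc] at hs
    rw [highWeight_add_half (by omega),
      show 2 * h / 2 - (l + 2) = h + l + 1 - (2 * l + 1) - 2 by omega,
      show 2 * h + 2 * (l + 2) - 1 - 2 * s + k = 2 * h + (2 * l + 1) + 2 - 2 * s + k by omega,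
      show 2 * (l + 2) - 2 = 2 * l + 1 + 1 by omega, show 2 * (l + 2) - 3 = 2 * l + 1 by omega,
      show 2 * h / 2 + (l + 2) - 2 = h + l + 1 - 1 by omega,
      show s + (l + 2) - 1 - 2 * h / 2 = s - (h + l + 1 - (2 * l + 1) - 1) by omega]
    split_ifs <;> ring

/-- For odd `n` the relevant antidiagonals start at `i + j = n + 2`, and the corner sequence enters
only the first of them. -/
theorem oddRestrictions [CharZero 𝕜] (hf : IsShiftArray n f) {α : ℕ → 𝕜} (hn : 3 ≤ n)
    (ho : Odd n) (h2 : f 1 n 2 = ((n : 𝕜) - 1) * α 3)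
    (h3 : ∀ k, 3 ≤ k → f 1 n k = 0) : OddRestrictions n α fun s k => f s s k := by
  obtain ⟨h, rfl⟩ := ho
  have key (k lo : ℕ) (hk : 1 ≤ k) (h1 : 1 ≤ lo) (hlo : 2 * lo ≤ k + 4) :
      (h - 1 / 2 : 𝕜) * f 1 (2 * h + 1) (k + 1) + ∑ s ∈ Icc lo ((2 * h + 1) / 2),
        (-1) ^ s * f s s (2 * h + 1 + 2 - 2 * s + k) *
          ∑ t ∈ Icc 1 s, ((((2 * h + 1) / 2 : ℕ) : 𝕜) - t + 1 / 2) *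
            coeffQ 𝕜 (s - t) (2 * h + 1 + 1 - 2 * s) = 0 := by
    have e := hf.relation_of_add_succ_eq (q := 0) (a := h + 1) (k := k) (by omega)
      (by omega) (by omega) hk
    rw [hf.sum_diag_eq_sum_diag le_rfl h1 (by omega)] at e
    rw [← e]
    congr 1
    · obtain ⟨h, rfl⟩ : ∃ h', h = h' + 1 := ⟨h - 1, by omega⟩
      rw [show 0 + 1 + k = k + 1 by ring]
      simp only [show h + 1 + 1 - 2 = h by omega, zero_add,
        Nat.choose_one_right, Nat.choose_zero_right]
      push_cast
      ring
    · refine sum_congr rfl fun s hs => ?_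
      rw [mem_Icc] at hs
      rw [mul_right_comm, highWeight, highWeight, mul_sum _ _ (1 / 2 : 𝕜), ← sum_add_distrib,
        add_zero]
      congr 2
      refine sum_congr rfl fun t ht => ?_
      rw [mem_Icc] at ht
      rw [show (2 * h + 1) / 2 = h by omega, cutChoose_of_le (q := 0) (by omega)]
      rcases eq_or_lt_of_le (by omega : t ≤ h) with rfl | hlt
      · rw [cutChoose_of_lt (by omega)]
        simp
      · rw [cutChoose_of_le (by omega)]
        simp [Nat.cast_sub hlt.le]
        ring
  refine ⟨?_, fun k hk hkn => ?_, fun l k hl hlh hk hkn => ?_⟩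
  · rw [← key 1 2 le_rfl (by norm_num) (by norm_num), h2]
    rw [show (2 * h + 1) / 2 = h by omega, ← mul_assoc]
    congr 1
    refine sum_congr rfl fun s hs => ?_
    rw [show 2 * h + 1 + 3 - 2 * s = 2 * h + 1 + 2 - 2 * s + 1 by have := mem_Icc.mp hs; omega]
  · rw [← key k ((k + 4) / 2) (by omega) (by omega) (by omega), h3 _ (by omega), mul_zero,
      zero_add]
  · obtain ⟨l, rfl⟩ := Nat.exists_eq_add_of_le' hl
    have e := hf.relation_of_add_succ_eq (q := 2 * l + 2) (a := h + l + 2) (k := k) (by omega)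
      (by omega) (by omega) hk
    rw [h3 _ (by omega), mul_zero, zero_add,
      hf.sum_diag_eq_sum_diag le_rfl (by omega : 1 ≤ k / 2 + (l + 3)) (by omega)] at e
    have hI : Icc (max ((2 * h + 1) / 2 - (l + 3) + 2) (k / 2 + (l + 3))) ((2 * h + 1) / 2) =
        (Icc (k / 2 + (l + 3)) ((2 * h + 1) / 2)).filter
          fun s => h + l + 2 - (2 * l + 2) - 1 ≤ s := by
      ext s
      simp only [mem_filter, mem_Icc]
      omega
    rw [hI, sum_filter, ← sum_add_distrib]
    refine Eq.trans (sum_congr rfl fun s hs => ?_) e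
    rw [mem_Icc] at hs
    rw [highWeight_add_half (by omega),
      show (2 * h + 1) / 2 - (l + 3) + 1 = h + l + 2 - (2 * l + 2) - 2 by omega,
      show 2 * h + 1 + 2 * (l + 3) - 2 - 2 * s + k = 2 * h + 1 + (2 * l + 2) + 2 - 2 * s + k by
        omega,
      show 2 * (l + 3) - 3 = 2 * l + 2 + 1 by omega, show 2 * (l + 3) - 4 = 2 * l + 2 by omega,
      show (2 * h + 1) / 2 + (l + 3) - 2 = h + l + 2 - 1 by omega,
      show s + (l + 3) - 2 - (2 * h + 1) / 2 = s - (h + l + 2 - (2 * l + 2) - 1) by omega]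
    split_ifs <;> ring

end IsShiftArray

/-! ### The array as a family of vectors -/

section Vectors

variable {𝕜 L : Type*} [Field 𝕜] [AddCommGroup L] [Module 𝕜 L]

/-- The `m`-th shift of a sequence that ends before `k = n`, as a combination of the vectors `e k`:
the summation may stop at any `N ≥ n - 1 - m`. -/
theorem sum_shift_smul_eq {n : ℕ} {γ : ℕ → 𝕜} (hγ : ∀ k, n ≤ k → γ k = 0) (e : ℕ → L) {m N : ℕ}
    (h1 : n ≤ N + m + 1) (h2 : N ≤ n - 1) :
    ∑ k ∈ Icc 1 (n - 1), γ (m + k) • e k = ∑ k ∈ Icc 1 N, γ (m + k) • e k := by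
  refine (sum_subset (Icc_subset_Icc_right h2) fun k hk hk' => ?_).symm
  simp only [mem_Icc] at hk hk'
  rw [hγ _ (by omega), zero_smul]

/-- The vector `∑ k, f i j k • e k` with the coordinates given by the array `f`. -/
def arrayVec (n : ℕ) (f : ℕ → ℕ → ℕ → 𝕜) (e : ℕ → L) (i j : ℕ) : L :=
  ∑ k ∈ Icc 1 (n - 1), f i j k • e k

theorem sum_Icc_split {M : Type*} [AddCommMonoid M] {lo A H : ℕ} (h : A ≤ H) (F : ℕ → M) :
    ∑ s ∈ Icc lo H, F s = ∑ s ∈ Icc lo A, F s + ∑ s ∈ Icc (max (A + 1) lo) H, F s := by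
  rw [← sum_union]
  · congr 1
    ext s
    simp only [mem_union, mem_Icc]
    omega
  · rw [disjoint_left]
    intro s hs hs'
    simp only [mem_Icc] at hs hs'
    omega

namespace IsShiftArray

variable {n : ℕ} {f : ℕ → ℕ → ℕ → 𝕜}

/-- The expansion along the diagonal with the sums over `k` cut off where the diagonal sequences
have ended. -/
theorem arrayVec_low [CharZero 𝕜] (hf : IsShiftArray n f) (e : ℕ → L) {a l : ℕ} (ha : 1 ≤ a)
    (hal : a + l ≤ n) :
    arrayVec n f e a (a + l) = ∑ s ∈ Icc 0 (l / 2),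
      ((-1) ^ s * coeffQ 𝕜 s (l + 1 - 2 * s)) •
        ∑ k ∈ Icc 1 (n + 2 * s - 1 - l), f (a + s) (a + s) (l - 2 * s + k) • e k := by
  rw [← Ico_add_one_right_eq_Icc 0, ← range_eq_Ico]
  have h : ∀ k ∈ Icc 1 (n - 1), f a (a + l) k • e k = ∑ s ∈ range (l / 2 + 1),
      ((-1) ^ s * coeffQ 𝕜 s (l + 1 - 2 * s)) • f (a + s) (a + s) (l - 2 * s + k) • e k := by
    intro k hk
    rw [hf.apply_eq_sum_diag ha hal (mem_Icc.mp hk).1, sum_smul]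
    simp only [mul_smul]
  rw [arrayVec, sum_congr rfl h, sum_comm]
  refine sum_congr rfl fun s hs => ?_
  rw [mem_range] at hs
  rw [← smul_sum, sum_shift_smul_eq
    (fun k hk => hf.diag_eq_zero (a + s) k (by omega) (by omega) hk) e
    (N := n + 2 * s - 1 - l) (by omega) (by omega)]

/-- The entries on the antidiagonal `a + j = n + q + 1`, in the form of the multiplication table.
The sum over `s` is split at `a - q - 1`, where the range of `t` changes from `s` to `a - q - 1`.
-/
theorem arrayVec_high [CharZero 𝕜] (hf : IsShiftArray n f) (e : ℕ → L) {q a j : ℕ}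
    (hj : a + j = n + q + 1) (hq : q + 2 ≤ a) (haj : a ≤ j) :
    arrayVec n f e a j =
      ((-1) ^ (a + q + 1) * ((a - 2).choose q : 𝕜)) •
        ∑ k ∈ Icc 1 (n - 1), f 1 n (q + k) • e k +
      (∑ s ∈ Icc (q / 2 + 2) (a - q - 1),
        ((-1) ^ (a + q + 1 + s) * ∑ t ∈ Icc 1 s,
          ((a - 1 - t).choose q : 𝕜) * coeffQ 𝕜 (s - t) (n + 1 - 2 * s)) •
            ∑ k ∈ Icc 1 (2 * s - (q + 2)), f s s (n + q + 1 - 2 * s + k) • e k +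
      ∑ s ∈ Icc (max (a - q - 1 + 1) (q / 2 + 2)) (n / 2),
        ((-1) ^ (a + q + 1 + s) * ∑ t ∈ Icc 1 (a - q - 1),
          ((a - 1 - t).choose q : 𝕜) * coeffQ 𝕜 (s - t) (n + 1 - 2 * s)) •
            ∑ k ∈ Icc 1 (2 * s - (q + 2)), f s s (n + q + 1 - 2 * s + k) • e k) := by
  have h : ∀ k ∈ Icc 1 (n - 1), f a j k • e k =
      ((-1) ^ (a + q + 1) * ((a - 2).choose q : 𝕜)) • f 1 n (q + k) • e k +
      ∑ s ∈ Icc 1 (n / 2), ((-1) ^ (a + q + 1 + s) * highWeight 𝕜 n q a s) •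
        f s s (n + q + 1 - 2 * s + k) • e k := by
    intro k hk
    rw [hf.apply_high q a j k hj (by omega) haj (mem_Icc.mp hk).1, add_smul, sum_smul]
    simp only [mul_smul]
  rw [arrayVec, sum_congr rfl h, sum_add_distrib, ← smul_sum, sum_comm]
  congr 1
  have h2 : ∑ s ∈ Icc 1 (n / 2), ∑ k ∈ Icc 1 (n - 1),
        ((-1) ^ (a + q + 1 + s) * highWeight 𝕜 n q a s) •
          f s s (n + q + 1 - 2 * s + k) • e k =
      ∑ s ∈ Icc (q / 2 + 2) (n / 2), ((-1) ^ (a + q + 1 + s) * highWeight 𝕜 n q a s) •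
        ∑ k ∈ Icc 1 (2 * s - (q + 2)), f s s (n + q + 1 - 2 * s + k) • e k := by
    rw [sum_subset (Icc_subset_Icc_left (by omega : 1 ≤ q / 2 + 2))]
    · refine sum_congr rfl fun s hs => ?_
      rw [mem_Icc] at hs
      rw [← smul_sum, sum_shift_smul_eq
        (fun k hk => hf.diag_eq_zero s k (by omega) (by omega) hk) e
        (N := 2 * s - (q + 2)) (by omega) (by omega)]
    · intro s hs hs'
      simp only [mem_Icc] at hs hs'
      rw [Icc_eq_empty (by omega), sum_empty, smul_zero]
  rw [h2, sum_Icc_split (by omega : a - q - 1 ≤ n / 2)]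
  congr 1
  · refine sum_congr rfl fun s hs => ?_
    rw [mem_Icc] at hs
    rw [highWeight_eq_sum (by omega), min_eq_left (by omega)]
  · refine sum_congr rfl fun s hs => ?_
    rw [mem_Icc] at hs
    rw [highWeight_eq_sum (by omega), min_eq_right (by omega)]

/-- The contribution of the corner sequence, when only its first two terms do not vanish. -/
theorem sum_corner_shift {A B : 𝕜} (e : ℕ → L) (hn : 3 ≤ n) (h1 : f 1 n 1 = A) (h2 : f 1 n 2 = B)
    (h3 : ∀ k, 3 ≤ k → f 1 n k = 0) :
    ∑ k ∈ Icc 1 (n - 1), f 1 n (0 + k) • e k = A • e 1 + B • e 2 ∧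
    ∑ k ∈ Icc 1 (n - 1), f 1 n (1 + k) • e k = B • e 1 ∧
    ∀ q, ∑ k ∈ Icc 1 (n - 1), f 1 n (q + 2 + k) • e k = 0 := by
  have hz (q k : ℕ) (h : 3 ≤ q + k) : f 1 n (q + k) • e k = 0 := by rw [h3 _ h, zero_smul]
  refine ⟨?_, ?_, fun q => sum_eq_zero fun k hk => hz _ _ (by have := mem_Icc.mp hk; omega)⟩
  · rw [← sum_subset (Icc_subset_Icc_right (by omega : 2 ≤ n - 1)) fun k hk hk' => hz _ _ (by
      simp only [mem_Icc] at hk hk'; omega)]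
    rw [sum_Icc_succ_top (by norm_num)]
    simp [h1, h2]
  · rw [← sum_subset (Icc_subset_Icc_right (by omega : 1 ≤ n - 1)) fun k hk hk' => hz _ _ (by
      simp only [mem_Icc] at hk hk'; omega)]
    simp [h2]

end IsShiftArray

end Vectors

/-! ### Normalized generators -/

/-- A normalized system in a Leibniz algebra `(L, μ)` with respect to a two-sided ideal `I`: the
vectors `e 1, …, e n` form a basis of `I` with coordinate functionals `κ k` (defined on all of `L`,
and zero for `k > n`), the vectors `x 1, …, x n` act on them as in the minimal faithful module and
multiply modulo `I` as in the filiform algebra, each `x (j + 1)`, `j ≥ 2`, is `-[x 1, x j]`, and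
`x 1`, `x 2` are chosen modulo `I` in such a way that `[x 1, x 1]`, `[x 2, x 1] + [x 1, x 2]` and
`[x 2, x 2]` have as few components as possible. The vector `x (n + 1) = -[x 1, x n]` lies in `I`;
including it makes the recursions uniform. -/
structure IsNormalized {𝕜 L : Type*} [Field 𝕜] [AddCommGroup L] [Module 𝕜 L]
    (μ : L →ₗ[𝕜] L →ₗ[𝕜] L) (I : Submodule 𝕜 L) (n : ℕ) (x e : ℕ → L) (κ : ℕ → L →ₗ[𝕜] 𝕜)
    (α : ℕ → 𝕜) : Prop where
  leibniz : IsLeibniz μ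
  mul_right_eq_zero : ∀ y, ∀ v ∈ I, μ y v = 0
  eq_sum_coord : ∀ v ∈ I, v = ∑ k ∈ Icc 1 n, κ k v • e k
  coord_e : ∀ k m, 1 ≤ m → m ≤ n → κ k (e m) = if k = m then 1 else 0
  coord_of_lt : ∀ k v, n < k → κ k v = 0
  e_mem : ∀ m, 1 ≤ m → m ≤ n → e m ∈ I
  e_x_one : ∀ m, 1 ≤ m → m ≤ n → μ (e m) (x 1) = if 2 ≤ m ∧ m < n then e (m - 1) else 0
  e_x : ∀ m j, 1 ≤ m → m ≤ n → 2 ≤ j → j ≤ n →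
    μ (e m) (x j) = if m = n then e (n + 1 - j) else 0
  x_x_mem : ∀ i j, 2 ≤ i → i ≤ n → 2 ≤ j → j ≤ n → μ (x i) (x j) ∈ I
  x_x_one_sub_mem : ∀ i, 2 ≤ i → i ≤ n → μ (x i) (x 1) - x (i + 1) ∈ I
  x_succ : ∀ j, 2 ≤ j → x (j + 1) = -μ (x 1) (x j)
  x_add_one_mem : x (n + 1) ∈ I
  x_one_x_one : μ (x 1) (x 1) = α 1 • e (n - 1) + α 2 • e n
  x_two_x_one : μ (x 2) (x 1) = x 3 + α 3 • e n
  coord_x_two_x_two : κ (n - 1) (μ (x 2) (x 2)) = 0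
  alpha_four : α 4 = -κ 1 (x (n + 1))
  alpha_five : α 5 = κ 1 (μ (x 2) (x n))

namespace IsNormalized

variable {𝕜 L : Type*} [Field 𝕜] [AddCommGroup L] [Module 𝕜 L] {μ : L →ₗ[𝕜] L →ₗ[𝕜] L}
  {I : Submodule 𝕜 L} {n : ℕ} {x e : ℕ → L} {κ : ℕ → L →ₗ[𝕜] 𝕜} {α : ℕ → 𝕜}

theorem mul_x_one_eq_sum (h : IsNormalized μ I n x e κ α) {v : L} (hv : v ∈ I) :
    μ v (x 1) = ∑ k ∈ Icc 1 n, κ k v • if 2 ≤ k ∧ k < n then e (k - 1) else 0 := by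
  conv_lhs => rw [h.eq_sum_coord v hv]
  rw [map_sum, LinearMap.sum_apply]
  refine sum_congr rfl fun k hk => ?_
  rw [mem_Icc] at hk
  rw [map_smul, LinearMap.smul_apply, h.e_x_one k hk.1 hk.2]

/-- The element `x 1` shifts the coordinates with indices `1, …, n - 1` and kills `e n`. -/
theorem coord_mul_x_one (h : IsNormalized μ I n x e κ α) {v : L} (hv : v ∈ I) (k : ℕ) :
    κ k (μ v (x 1)) = if 1 ≤ k ∧ k + 1 < n then κ (k + 1) v else 0 := by
  have h1 : ∀ m ∈ Icc 1 n, κ k (κ m v • if 2 ≤ m ∧ m < n then e (m - 1) else 0) =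
      if m = k + 1 then (if 1 ≤ k ∧ k + 1 < n then κ (k + 1) v else 0) else 0 := by
    intro m hm
    rw [mem_Icc] at hm
    by_cases hm2 : 2 ≤ m ∧ m < n
    · rw [if_pos hm2, map_smul, h.coord_e k (m - 1) (by omega) (by omega)]
      by_cases hk : m = k + 1
      · subst hk
        rw [if_pos (by omega), if_pos rfl, if_pos (by omega), smul_eq_mul, mul_one]
      · rw [if_neg (by omega), if_neg hk, smul_zero]
    · rw [if_neg hm2, smul_zero, map_zero]
      split_ifs
      · omega
      · rfl
      · rfl
  rw [h.mul_x_one_eq_sum hv, map_sum, sum_congr rfl h1, sum_ite_eq']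
  split_ifs with h2 h3 h3
  · rfl
  · rfl
  · exact absurd (mem_Icc.mpr (by omega)) h2
  · rfl

theorem coord_mul_x_one_of_coord_eq_zero (h : IsNormalized μ I n x e κ α) {v : L} (hv : v ∈ I)
    (hvn : κ n v = 0) {k : ℕ} (hk : 1 ≤ k) : κ k (μ v (x 1)) = κ (k + 1) v := by
  rw [h.coord_mul_x_one hv]
  rcases lt_trichotomy (k + 1) n with hkn | hkn | hkn
  · rw [if_pos ⟨hk, hkn⟩]
  · rw [if_neg (by omega), hkn, hvn]
  · rw [if_neg (by omega), h.coord_of_lt _ _ hkn]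

theorem mul_x (h : IsNormalized μ I n x e κ α) {v : L} (hv : v ∈ I) {j : ℕ} (hj : 2 ≤ j)
    (hjn : j ≤ n) : μ v (x j) = κ n v • e (n + 1 - j) := by
  conv_lhs => rw [h.eq_sum_coord v hv]
  rw [map_sum, LinearMap.sum_apply, sum_eq_single n]
  · rw [map_smul, LinearMap.smul_apply, h.e_x n j (by omega) le_rfl hj hjn, if_pos rfl]
  · intro m hm hmn
    rw [mem_Icc] at hm
    rw [map_smul, LinearMap.smul_apply, h.e_x m j hm.1 hm.2 hj hjn, if_neg hmn, smul_zero]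
  · intro hn
    exact absurd (mem_Icc.mpr (by omega)) hn

theorem mul_eq_of_sub_mem (h : IsNormalized μ I n x e κ α) {y v w : L} (hvw : v - w ∈ I) :
    μ y v = μ y w := by
  rw [← sub_eq_zero, ← map_sub, h.mul_right_eq_zero y _ hvw]

theorem mul_x_x_one (h : IsNormalized μ I n x e κ α) (y : L) {i : ℕ} (hi : 2 ≤ i) (hin : i ≤ n) :
    μ y (μ (x i) (x 1)) = μ y (x (i + 1)) :=
  h.mul_eq_of_sub_mem (h.x_x_one_sub_mem i hi hin)

theorem eq_sum_coord_of_coord_eq_zero (h : IsNormalized μ I n x e κ α) {v : L} (hv : v ∈ I)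
    (hvn : κ n v = 0) : v = ∑ k ∈ Icc 1 (n - 1), κ k v • e k := by
  conv_lhs => rw [h.eq_sum_coord v hv]
  refine (sum_subset (Icc_subset_Icc_right (Nat.sub_le n 1)) fun k hk hk' => ?_).symm
  simp only [mem_Icc] at hk hk'
  rw [show k = n by omega, hvn, zero_smul]

/-- A vector of `I` on which `x 1` acts as on a multiple of `e 2`. -/
theorem eq_of_mul_x_one_eq (h : IsNormalized μ I n x e κ α) (hn : 3 ≤ n) {v : L} (hv : v ∈ I)
    (hvn : κ n v = 0) {c : 𝕜} (hc : μ v (x 1) = c • e 1) : v = κ 1 v • e 1 + c • e 2 := by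
  have h1 (k : ℕ) (hk : 1 ≤ k) : κ (k + 1) v = if k = 1 then c else 0 := by
    rw [← h.coord_mul_x_one_of_coord_eq_zero hv hvn hk, hc, map_smul,
      h.coord_e k 1 le_rfl (by omega)]
    simp
  conv_lhs => rw [h.eq_sum_coord_of_coord_eq_zero hv hvn]
  rw [← sum_subset (Icc_subset_Icc_right (by omega : 2 ≤ n - 1))]
  · rw [sum_Icc_succ_top (by norm_num), Icc_self, sum_singleton, h1 1 le_rfl, if_pos rfl]
  · intro k hk hk'
    simp only [mem_Icc] at hk hk'
    obtain ⟨k, rfl⟩ : ∃ k', k = k' + 1 := ⟨k - 1, by omega⟩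
    rw [h1 k (by omega), if_neg (by omega), zero_smul]

theorem x_x_one (h : IsNormalized μ I n x e κ α) {i : ℕ} (hi : 3 ≤ i) (hin : i ≤ n) :
    μ (x i) (x 1) = x (i + 1) - α 2 • e (n + 2 - i) := by
  obtain ⟨i, rfl⟩ : ∃ i', i = i' + 1 := ⟨i - 1, by omega⟩
  have h1 := h.leibniz (x 1) (x i) (x 1)
  rw [h.mul_x_x_one _ (by omega) (by omega), h.x_one_x_one, map_add, map_smul, map_smul,
    LinearMap.add_apply, LinearMap.smul_apply, LinearMap.smul_apply,
    h.e_x _ i (by omega) (by omega) (by omega) (by omega), if_neg (by omega),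
    h.e_x _ i (by omega) (by omega) (by omega) (by omega), if_pos rfl, smul_zero, zero_add] at h1
  rw [h.x_succ i (by omega), map_neg, LinearMap.neg_apply, h1, h.x_succ (i + 1) (by omega),
    h.x_succ i (by omega), show n + 2 - (i + 1) = n + 1 - i by omega]
  abel

theorem x_succ_x_comm (h : IsNormalized μ I n x e κ α) {i j : ℕ} (hi : 2 ≤ i) (hin : i ≤ n)
    (hj : 2 ≤ j) (hjn : j ≤ n) : μ (x (i + 1)) (x j) = μ (x (j + 1)) (x i) := by
  have h1 := h.leibniz (x 1) (x i) (x j)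
  rw [h.mul_right_eq_zero _ _ (h.x_x_mem i j hi hin hj hjn), add_zero] at h1
  rw [h.x_succ i hi, h.x_succ j hj, map_neg, map_neg, LinearMap.neg_apply, LinearMap.neg_apply, h1]

/-- By the Leibniz identity, `[[x i, x j], x k] = [[x i, x k], x j]` for indices at least `2`. The
two sides are multiples of the different vectors `e (n + 1 - k)` and `e (n + 1 - j)` when `j ≠ k`.
-/
theorem coord_x_x (h : IsNormalized μ I n x e κ α) (hn : 3 ≤ n) {i j : ℕ} (hi : 2 ≤ i)
    (hin : i ≤ n) (hj : 2 ≤ j) (hjn : j ≤ n) : κ n (μ (x i) (x j)) = 0 := by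
  obtain ⟨k, hk, hkn, hkj⟩ : ∃ k, 2 ≤ k ∧ k ≤ n ∧ k ≠ j := by
    rcases eq_or_ne j 2 with rfl | hj2
    · exact ⟨3, by norm_num, hn, by norm_num⟩
    · exact ⟨2, le_rfl, by omega, hj2.symm⟩
  have h1 := h.leibniz (x i) (x j) (x k)
  rw [h.mul_right_eq_zero _ _ (h.x_x_mem j k hj hjn hk hkn), add_zero,
    h.mul_x (h.x_x_mem i j hi hin hj hjn) hk hkn,
    h.mul_x (h.x_x_mem i k hi hin hk hkn) hj hjn] at h1
  have h2 := congrArg (κ (n + 1 - k)) h1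
  rw [map_smul, map_smul, h.coord_e _ _ (by omega) (by omega), if_pos rfl,
    h.coord_e _ _ (by omega) (by omega), if_neg (by omega), smul_zero, smul_eq_mul, mul_one] at h2
  exact h2

theorem x_two_x_mul_x_one (h : IsNormalized μ I n x e κ α) (hn : 3 ≤ n) {j : ℕ} (hj : 2 ≤ j)
    (hjn : j ≤ n) : μ (μ (x 2) (x j)) (x 1) =
      μ (x 3) (x j) + μ (x 2) (x (j + 1)) + α 3 • e (n + 1 - j) := by
  rw [h.leibniz (x 2) (x j) (x 1), h.mul_x_x_one _ hj hjn, h.x_two_x_one, map_add, map_smul,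
    LinearMap.add_apply, LinearMap.smul_apply, h.e_x n j (by omega) le_rfl hj hjn, if_pos rfl]
  abel

theorem x_x_mul_x_one (h : IsNormalized μ I n x e κ α) {i j : ℕ} (hi : 3 ≤ i) (hin : i ≤ n)
    (hj : 2 ≤ j) (hjn : j ≤ n) :
    μ (μ (x i) (x j)) (x 1) = μ (x (i + 1)) (x j) + μ (x i) (x (j + 1)) := by
  rw [h.leibniz (x i) (x j) (x 1), h.mul_x_x_one _ hj hjn, h.x_x_one hi hin, map_sub, map_smul,
    LinearMap.sub_apply, LinearMap.smul_apply, h.e_x _ j (by omega) (by omega) hj hjn,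
    if_neg (by omega), smul_zero, sub_zero]

/-- The component of `[x 1, x n]` along `e n` vanishes: up to sign it is the component of `[x 3, x n]`
along `e (n - 1)`, and `[x 3, x n]` differs by a multiple of `e 1` from an element of `[I, x 1]`. -/
theorem coord_x_add_one (h : IsNormalized μ I n x e κ α) (hn : 3 ≤ n) : κ n (x (n + 1)) = 0 := by
  have h1 := h.x_two_x_mul_x_one hn (by omega : 2 ≤ n) le_rfl
  rw [h.mul_right_eq_zero _ _ h.x_add_one_mem, add_zero,
    h.x_succ_x_comm (i := 2) (j := n) le_rfl (by omega) (by omega) le_rfl,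
    h.mul_x h.x_add_one_mem le_rfl (by omega), show n + 1 - 2 = n - 1 by omega] at h1
  have h2 := congrArg (κ (n - 1)) h1
  rw [h.coord_mul_x_one (h.x_x_mem 2 n le_rfl (by omega) (by omega) le_rfl), if_neg (by omega),
    map_add, map_smul, map_smul, h.coord_e _ _ (by omega) (by omega), if_pos rfl,
    h.coord_e _ _ (by omega) (by omega), if_neg (by omega), smul_zero, smul_eq_mul, mul_one,
    add_zero] at h2
  exact h2.symm

theorem x_add_one_x (h : IsNormalized μ I n x e κ α) (hn : 3 ≤ n) {j : ℕ} (hj : 2 ≤ j)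
    (hjn : j ≤ n) : μ (x (n + 1)) (x j) = 0 := by
  rw [h.mul_x h.x_add_one_mem hj hjn, h.coord_x_add_one hn, zero_smul]

theorem x_succ_x_last (h : IsNormalized μ I n x e κ α) (hn : 3 ≤ n) {i : ℕ} (hi : 2 ≤ i)
    (hin : i ≤ n) : μ (x (i + 1)) (x n) = 0 := by
  rw [h.x_succ_x_comm hi hin (by omega) le_rfl, h.x_add_one_x hn hi hin]

theorem x_add_one_eq (h : IsNormalized μ I n x e κ α) (hn : 3 ≤ n) :
    x (n + 1) = -(α 4 • e 1) - α 2 • e 2 := by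
  have h1 := h.leibniz (x 1) (x n) (x 1)
  rw [h.mul_x_x_one _ (by omega) le_rfl, h.mul_right_eq_zero _ _ h.x_add_one_mem, add_zero,
    h.x_one_x_one, map_add, map_smul, map_smul,
    LinearMap.add_apply, LinearMap.smul_apply, LinearMap.smul_apply,
    h.e_x _ n (by omega) (by omega) (by omega) (by omega), if_neg (by omega),
    h.e_x _ n (by omega) (by omega) (by omega) (by omega), if_pos rfl, smul_zero, zero_add] at h1
  have h2 : μ (x (n + 1)) (x 1) = (-α 2) • e 1 := by
    rw [h.x_succ n (by omega), map_neg, LinearMap.neg_apply, h1, neg_smul,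
      show n + 1 - n = 1 by omega]
  have h3 := h.eq_of_mul_x_one_eq hn h.x_add_one_mem (h.coord_x_add_one hn) h2
  rw [h.alpha_four, neg_smul, neg_neg, sub_eq_add_neg, ← neg_smul]
  exact h3

theorem x_two_x_last (h : IsNormalized μ I n x e κ α) (hn : 3 ≤ n) :
    μ (x 2) (x n) = α 5 • e 1 + α 3 • e 2 := by
  have h1 := h.x_two_x_mul_x_one hn (by omega : 2 ≤ n) le_rfl
  rw [h.mul_right_eq_zero _ _ h.x_add_one_mem, add_zero, h.x_succ_x_last hn le_rfl (by omega),
    zero_add, show n + 1 - n = 1 by omega] at h1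
  rw [h.alpha_five]
  exact h.eq_of_mul_x_one_eq hn (h.x_x_mem 2 n le_rfl (by omega) (by omega) le_rfl)
    (h.coord_x_x hn le_rfl (by omega) (by omega) le_rfl) h1

end IsNormalized

/-! ### The array of a normalized system -/

section Array

variable {𝕜 L : Type*} [Field 𝕜] [AddCommGroup L] [Module 𝕜 L]

/-- The coordinates of `[x 2, x j]`, corrected by a multiple of `e (n + 2 - j)` that absorbs the
component of `[x 2, x 1]` along `e n`. -/
def firstRow (μ : L →ₗ[𝕜] L →ₗ[𝕜] L) (n : ℕ) (x : ℕ → L) (κ : ℕ → L →ₗ[𝕜] 𝕜) (a : 𝕜)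
    (j k : ℕ) : 𝕜 :=
  κ k (μ (x 2) (x j)) + if k + j = n + 2 then ((j : 𝕜) - 2) * a else 0

/-- The array with entries `f i j k = κ k [x (i + 1), x j]` for `i ≥ 2`, `j ≥ 2`. The row and the
column with index `1` hold the corrected coordinates of `[x 2, x j]`, and the corner `f 1 1` is
twice the sequence of `[x 2, x 2]`, shifted backwards, so that `f 1 2` is half of its shift. -/
def bracketArray (μ : L →ₗ[𝕜] L →ₗ[𝕜] L) (n : ℕ) (x : ℕ → L) (κ : ℕ → L →ₗ[𝕜] 𝕜) (a : 𝕜)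
    (i j k : ℕ) : 𝕜 :=
  if i = 1 then
    if j = 1 then 2 * κ (k - 1) (μ (x 2) (x 2)) else firstRow μ n x κ a j k
  else if j = 1 then firstRow μ n x κ a i k else κ k (μ (x (i + 1)) (x j))

end Array

namespace IsNormalized

variable {𝕜 L : Type*} [Field 𝕜] [AddCommGroup L] [Module 𝕜 L] {μ : L →ₗ[𝕜] L →ₗ[𝕜] L}
  {I : Submodule 𝕜 L} {n : ℕ} {x e : ℕ → L} {κ : ℕ → L →ₗ[𝕜] 𝕜} {α : ℕ → 𝕜}

theorem bracketArray_of_two_le {a : 𝕜} {i j : ℕ} (hi : 2 ≤ i) (hj : 2 ≤ j) (k : ℕ) :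
    bracketArray μ n x κ a i j k = κ k (μ (x (i + 1)) (x j)) := by
  rw [bracketArray, if_neg (by omega), if_neg (by omega)]

theorem bracketArray_one {a : 𝕜} {j : ℕ} (hj : 2 ≤ j) (k : ℕ) :
    bracketArray μ n x κ a 1 j k = firstRow μ n x κ a j k := by
  rw [bracketArray, if_pos rfl, if_neg (by omega)]

theorem bracketArray_comm (h : IsNormalized μ I n x e κ α) {a : 𝕜} {i j : ℕ} (hi : 1 ≤ i)
    (hin : i ≤ n) (hj : 1 ≤ j) (hjn : j ≤ n) (k : ℕ) :
    bracketArray μ n x κ a i j k = bracketArray μ n x κ a j i k := by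
  unfold bracketArray
  by_cases h1 : i = 1 <;> by_cases h2 : j = 1
  · simp [h1, h2]
  · simp [h1, h2]
  · simp [h1, h2]
  · rw [if_neg h1, if_neg h2, if_neg h2, if_neg h1,
      h.x_succ_x_comm (by omega) hin (by omega) hjn]

theorem coord_eq_zero_of_le (h : IsNormalized μ I n x e κ α) {v : L} (hv : κ n v = 0) {k : ℕ}
    (hk : n ≤ k) : κ k v = 0 := by
  rcases eq_or_lt_of_le hk with rfl | hk
  · exact hv
  · exact h.coord_of_lt k v hk

theorem bracketArray_shift_one (h : IsNormalized μ I n x e κ α) (hn : 3 ≤ n) {j k : ℕ}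
    (hj : 1 ≤ j) (hjn : j < n) (hk : 1 ≤ k) :
    bracketArray μ n x κ (α 3) 1 (j + 1) k + bracketArray μ n x κ (α 3) 2 j k =
      bracketArray μ n x κ (α 3) 1 j (k + 1) := by
  rcases eq_or_lt_of_le hj with rfl | hj
  · simp only [bracketArray, firstRow, if_true, if_false, OfNat.ofNat_ne_one, one_add_one_eq_two,
      Nat.add_sub_cancel]
    simp
    ring
  · rw [bracketArray_one (by omega), bracketArray_of_two_le le_rfl hj, bracketArray_one hj,
      firstRow, firstRow, ← h.coord_mul_x_one_of_coord_eq_zero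
        (h.x_x_mem 2 j le_rfl (by omega) hj hjn.le) (h.coord_x_x hn le_rfl (by omega) hj hjn.le) hk,
      h.x_two_x_mul_x_one hn hj hjn.le, map_add, map_add, map_smul,
      h.coord_e _ _ (by omega) (by omega)]
    by_cases hkj : k + 1 + j = n + 2
    · rw [if_pos (by omega), if_pos (by omega), if_pos hkj]
      push_cast
      simp only [smul_eq_mul]
      ring
    · rw [if_neg (by omega), if_neg (by omega), if_neg hkj]
      simp only [smul_eq_mul]
      ring

/-- The Leibniz identity, in terms of the array of coordinates. -/
theorem isShiftArray (h : IsNormalized μ I n x e κ α) (hn : 3 ≤ n) :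
    IsShiftArray n (bracketArray μ n x κ (α 3)) where
  symm i j k hi hin hj hjn := h.bracketArray_comm hi hin hj hjn k
  shift i j k hi hin hj hjn hk := by
    rcases eq_or_lt_of_le hi with rfl | hi
    · exact h.bracketArray_shift_one hn hj hjn hk
    rcases eq_or_lt_of_le hj with rfl | hj
    · rw [h.bracketArray_comm (by omega) hin.le (by omega) (by omega),
        h.bracketArray_comm (by omega) (by omega) le_rfl (by omega),
        h.bracketArray_comm (by omega) hin.le le_rfl (by omega), add_comm]
      exact h.bracketArray_shift_one hn (by omega) hin hk
    rw [bracketArray_of_two_le hi (by omega), bracketArray_of_two_le (by omega) hj,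
      bracketArray_of_two_le hi hj, ← h.coord_mul_x_one_of_coord_eq_zero
        (h.x_x_mem (i + 1) j (by omega) hin hj hjn.le)
        (h.coord_x_x hn (by omega) hin hj hjn.le) hk,
      h.x_x_mul_x_one (by omega) hin hj hjn.le, map_add, add_comm]
  last i k hi hin := by
    rw [bracketArray_of_two_le hi (by omega), h.x_succ_x_last hn hi hin, map_zero]
  diag_eq_zero i k hi hin hk := by
    rcases eq_or_lt_of_le hi with rfl | hi
    · have h1 : κ (k - 1) (μ (x 2) (x 2)) = 0 := by
        rcases eq_or_lt_of_le hk with rfl | hk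
        · exact h.coord_x_two_x_two
        · exact h.coord_eq_zero_of_le (h.coord_x_x hn le_rfl (by omega) le_rfl (by omega))
            (by omega)
      simp [bracketArray, h1]
    · rw [bracketArray_of_two_le hi hi]
      rcases eq_or_lt_of_le hin with rfl | hin
      · rw [h.x_add_one_x hn hi le_rfl, map_zero]
      · exact h.coord_eq_zero_of_le (h.coord_x_x hn (by omega) hin hi hin.le) hk

theorem x_succ_x_eq_arrayVec (h : IsNormalized μ I n x e κ α) (hn : 3 ≤ n) {i j : ℕ}
    (hi : 2 ≤ i) (hin : i < n) (hj : 2 ≤ j) (hjn : j ≤ n) :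
    μ (x (i + 1)) (x j) = arrayVec n (bracketArray μ n x κ (α 3)) e i j := by
  conv_lhs => rw [h.eq_sum_coord_of_coord_eq_zero (h.x_x_mem (i + 1) j (by omega) hin hj hjn)
    (h.coord_x_x hn (by omega) hin hj hjn)]
  exact sum_congr rfl fun k _ => by rw [bracketArray_of_two_le hi hj]

theorem x_two_x_eq_arrayVec (h : IsNormalized μ I n x e κ α) (hn : 3 ≤ n) {j : ℕ}
    (hj : 3 ≤ j) (hjn : j ≤ n) :
    μ (x 2) (x j) = -((((j : 𝕜) - 2) * α 3) • e (n + 2 - j)) +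
      arrayVec n (bracketArray μ n x κ (α 3)) e 1 j := by
  have h1 : (((j : 𝕜) - 2) * α 3) • e (n + 2 - j) =
      ∑ k ∈ Icc 1 (n - 1), (if k + j = n + 2 then ((j : 𝕜) - 2) * α 3 else 0) • e k := by
    rw [sum_eq_single (n + 2 - j), if_pos (by omega)]
    · intro k _ hk
      rw [if_neg (by omega), zero_smul]
    · intro hk
      exact absurd (mem_Icc.mpr (by omega)) hk
  rw [h1, neg_add_eq_sub, arrayVec, ← sum_sub_distrib]
  conv_lhs => rw [h.eq_sum_coord_of_coord_eq_zero
    (h.x_x_mem 2 j le_rfl (by omega) (by omega) hjn)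
    (h.coord_x_x hn le_rfl (by omega) (by omega) hjn)]
  refine sum_congr rfl fun k _ => ?_
  rw [bracketArray_one (by omega), firstRow, ← sub_smul, add_sub_cancel_right]

/-- The last entry of the first row: apart from it, the last column of the array vanishes. -/
theorem bracketArray_corner (h : IsNormalized μ I n x e κ α) (hn : 3 ≤ n) :
    bracketArray μ n x κ (α 3) 1 n 1 = α 5 ∧
    bracketArray μ n x κ (α 3) 1 n 2 = ((n : 𝕜) - 1) * α 3 ∧
    ∀ k, 3 ≤ k → bracketArray μ n x κ (α 3) 1 n k = 0 := by
  have h1 (k : ℕ) : bracketArray μ n x κ (α 3) 1 n k = (if k = 1 then α 5 else 0) +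
      (if k = 2 then α 3 else 0) + if k = 2 then ((n : 𝕜) - 2) * α 3 else 0 := by
    rw [bracketArray_one (by omega), firstRow, h.x_two_x_last hn, map_add, map_smul, map_smul,
      h.coord_e _ 1 le_rfl (by omega), h.coord_e _ 2 (by norm_num) (by omega)]
    simp [add_comm k n]
  refine ⟨by simp [h1], ?_, fun k hk => ?_⟩
  · rw [h1, if_neg (by norm_num), if_pos rfl, if_pos rfl]
    ring
  · rw [h1, if_neg (by omega), if_neg (by omega), if_neg (by omega), add_zero, add_zero]

end IsNormalized

/-! ### The multiplication table of a normalized system -/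

namespace IsNormalized

variable {𝕜 L : Type*} [Field 𝕜] [AddCommGroup L] [Module 𝕜 L] {μ : L →ₗ[𝕜] L →ₗ[𝕜] L}
  {I : Submodule 𝕜 L} {n : ℕ} {x e : ℕ → L} {κ : ℕ → L →ₗ[𝕜] 𝕜} {α : ℕ → 𝕜}

/-- In the expansion of the first row, the term `s = 0` comes from the corner `f 1 1` and reproduces
the shifts of `[x 2, x 2]`; the other terms are reindexed by `s + 1`. -/
theorem x_two_x_eq [CharZero 𝕜] (h : IsNormalized μ I n x e κ α) (hn : 3 ≤ n) {j : ℕ}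
    (hj : 3 ≤ j) (hjn : j ≤ n - 1) :
    μ (x 2) (x j) = -((((j : 𝕜) - 2) * α 3) • e (n + 2 - j)) +
      ∑ k ∈ Icc 1 (n - j), κ (j - 2 + k) (μ (x 2) (x 2)) • e k +
      ∑ s ∈ Icc 2 ((j + 1) / 2), ((-1) ^ (s + 1) * coeffQ 𝕜 (s - 1) (j + 2 - 2 * s)) •
        ∑ k ∈ Icc 1 (n + 2 * s - 2 - j),
          bracketArray μ n x κ (α 3) s s (j + 1 - 2 * s + k) • e k := by
  obtain ⟨l, rfl⟩ : ∃ l, j = 1 + (l + 2) := ⟨j - 3, by omega⟩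
  rw [h.x_two_x_eq_arrayVec hn hj (by omega),
    (h.isShiftArray hn).arrayVec_low e le_rfl (by omega), add_assoc (-_)]
  congr 1
  rw [← Ico_add_one_right_eq_Icc 0, sum_eq_sum_Ico_succ_bot (by omega)]
  congr 1
  · rw [show l + 2 + 1 - 2 * 0 = (l + 1) + 2 by omega, coeffQ_zero_add_two, smul_sum,
      show n + 2 * 0 - 1 - (l + 2) = n - (1 + (l + 2)) by omega]
    refine sum_congr rfl fun k _ => ?_
    rw [bracketArray, if_pos rfl, if_pos rfl, smul_smul,
      show l + 2 - 2 * 0 + k - 1 = 1 + (l + 2) - 2 + k by omega]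
    congr 1
    field_simp
  · rw [← Ico_add_one_right_eq_Icc 2, show (1 + (l + 2) + 1) / 2 + 1 = (l + 2) / 2 + 1 + 1 by omega,
      show (2 : ℕ) = 0 + 1 + 1 from rfl, ← sum_Ico_add' _ (0 + 1) _ 1]
    refine sum_congr rfl fun s hs => ?_
    rw [mem_Ico] at hs
    rw [show l + (0 + 1 + 1) + 1 - (0 + 1 + 1) * s = 1 + (l + 2) + 2 - 2 * (s + 1) by omega,
      show n + (0 + 1 + 1) * s - 1 - (l + (0 + 1 + 1)) = n + 2 * (s + 1) - 2 - (1 + (l + 2)) by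
        omega,
      show l + (0 + 1 + 1) - (0 + 1 + 1) * s = 1 + (l + 2) + 1 - 2 * (s + 1) by omega,
      show s + 1 - 1 = s by omega, add_comm 1 s, pow_add _ (s + 1) 1, pow_add _ s 1]
    simp

theorem hasTable [CharZero 𝕜] (h : IsNormalized μ I n x e κ α) (hn : 3 ≤ n) :
    HasTable μ n x e α (fun k => κ k (μ (x 2) (x 2)))
      (fun s k => bracketArray μ n x κ (α 3) s s k) where
  e_x1 i hi hin := by rw [h.e_x_one i (by omega) (by omega), if_pos (by omega)]
  en_x j hj hjn := by rw [h.e_x n j (by omega) le_rfl hj hjn, if_pos rfl]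
  e1_x1 := by rw [h.e_x_one 1 (by omega) (by omega), if_neg (by omega)]
  en_x1 := by rw [h.e_x_one n (by omega) (by omega), if_neg (by omega)]
  e_x i j hi hin hj hjn := by rw [h.e_x i j hi (by omega) hj hjn, if_neg (by omega)]
  x_e i j _ _ hj hjn := h.mul_right_eq_zero _ _ (h.e_mem j hj hjn)
  e_e i j _ _ hj hjn := h.mul_right_eq_zero _ _ (h.e_mem j hj hjn)
  x1_x1 := h.x_one_x_one
  x1_x j hj _ := by rw [h.x_succ j hj, neg_neg]
  x2_x1 := h.x_two_x_one
  x_x1 i hi hin := h.x_x_one hi (by omega)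
  x1_xn := by
    have h1 := h.x_succ n (by omega)
    rw [h.x_add_one_eq hn] at h1
    rw [← neg_neg (μ (x 1) (x n)), ← h1]
    abel
  xn_x1 := by
    rw [h.x_x_one hn le_rfl, h.x_add_one_eq hn, show n + 2 - n = 2 by omega, two_mul, add_smul]
    abel
  x2_xn := h.x_two_x_last hn
  x_xn i hi hin := by
    obtain ⟨i, rfl⟩ : ∃ i', i = i' + 1 := ⟨i - 1, by omega⟩
    exact h.x_succ_x_last hn (by omega) (by omega)
  x2_x2 := by
    conv_lhs => rw [h.eq_sum_coord_of_coord_eq_zero (h.x_x_mem 2 2 le_rfl (by omega) le_rfl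
      (by omega)) (h.coord_x_x hn le_rfl (by omega) le_rfl (by omega))]
    rw [show n - 1 = n - 2 + 1 by omega, sum_Icc_succ_top (by omega),
      show n - 2 + 1 = n - 1 by omega, h.coord_x_two_x_two, zero_smul, add_zero]
  x_succ i hi hin := h.x_succ_x_eq_arrayVec hn hi (by omega) hi (by omega)
  x_low i j hj hi hin := by
    obtain ⟨a, rfl⟩ : ∃ a, i = a + 1 := ⟨i - 1, by omega⟩
    rw [h.x_succ_x_eq_arrayVec hn (by omega) (by omega) (by omega) (by omega),
      show a + 1 + j = a + (j + 1) by ring,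
      (h.isShiftArray hn).arrayVec_low e (by omega) (by omega)]
    refine sum_congr rfl fun s hs => ?_
    rw [show j + 1 + 1 = j + 2 by ring, show n + 2 * s - 1 - (j + 1) = n + 2 * s - 2 - j by omega,
      show a + 1 + s - 1 = a + s by omega]
  x2_x j hj hjn := h.x_two_x_eq hn hj hjn
  x_high2 i hi hin := by
    obtain ⟨a, rfl⟩ : ∃ a, i = a + 1 := ⟨i - 1, by omega⟩
    obtain ⟨h1, h2, h3⟩ := h.bracketArray_corner hn
    rw [h.x_succ_x_eq_arrayVec hn (by omega) (by omega) (by omega) (by omega),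
      (h.isShiftArray hn).arrayVec_high (q := 0) e (by omega) (by omega) (by omega),
      (IsShiftArray.sum_corner_shift e hn h1 h2 h3).1, ← add_assoc,
      show a - 0 - 1 = a + 1 - 2 by omega,
      max_eq_left (by omega), show a + 1 - 2 + 1 = a + 1 - 1 by omega]
    congr 1
    · congr 1
      · simp [smul_smul, mul_assoc]
      · refine sum_congr rfl fun s _ => ?_
        simp [add_comm s]
    · refine sum_congr rfl fun s _ => ?_
      simp [add_comm s]
  x_high3 i hi hin := by
    obtain ⟨a, rfl⟩ : ∃ a, i = a + 1 := ⟨i - 1, by omega⟩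
    obtain ⟨h1, h2, h3⟩ := h.bracketArray_corner hn
    have hc (t : ℕ) (ht : t + 2 ≤ a) :
        ((a - 1 - t).choose 1 : 𝕜) = ((a + 1 : ℕ) : 𝕜) - 2 - t := by
      obtain ⟨b, rfl⟩ := Nat.exists_eq_add_of_le ht
      rw [Nat.choose_one_right, show t + 2 + b - 1 - t = b + 1 by omega]
      push_cast
      ring
    rw [h.x_succ_x_eq_arrayVec hn (by omega) (by omega) (by omega) (by omega),
      (h.isShiftArray hn).arrayVec_high (q := 1) e (by omega) (by omega) (by omega),
      (IsShiftArray.sum_corner_shift e hn h1 h2 h3).2.1, ← add_assoc,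
      show a - 1 - 1 = a + 1 - 3 by omega,
      max_eq_left (by omega), show a + 1 - 3 + 1 = a + 1 - 2 by omega]
    congr 1
    · congr 1
      · rw [show a - 2 = a - 1 - 1 by omega, hc 1 (by omega), smul_smul]
        congr 1
        push_cast
        ring
      · refine sum_congr rfl fun s hs => ?_
        rw [mem_Icc] at hs
        rw [show a + 1 + 1 + s = s + (a + 1) + 1 by ring]
        congr 2
        refine sum_congr rfl fun t ht => ?_
        rw [mem_Icc] at ht
        rw [hc t (by omega)]
    · refine sum_congr rfl fun s hs => ?_
      rw [show a + 1 + 1 + s = s + (a + 1) + 1 by ring]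
      congr 2
      refine sum_congr rfl fun t ht => ?_
      rw [mem_Icc] at ht
      rw [hc t (by omega)]
  x_high p i hp hpn hi hin := by
    obtain ⟨a, rfl⟩ : ∃ a, i = a + 1 := ⟨i - 1, by omega⟩
    obtain ⟨q, rfl⟩ : ∃ q, p = q + 2 + 2 := ⟨p - 4, by omega⟩
    obtain ⟨h1, h2, h3⟩ := h.bracketArray_corner hn
    have hsgn (s : ℕ) : (-1 : 𝕜) ^ (s + (a + 1) + (q + 2 + 2)) = (-1) ^ (a + (q + 2) + 1 + s) := by
      rw [show s + (a + 1) + (q + 2 + 2) = a + (q + 2) + 1 + s + 2 by ring, pow_add _ _ 2]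
      simp
    rw [h.x_succ_x_eq_arrayVec hn (by omega) (by omega) (by omega) (by omega),
      (h.isShiftArray hn).arrayVec_high (q := q + 2) e (by omega) (by omega) (by omega),
      (IsShiftArray.sum_corner_shift e hn h1 h2 h3).2.2, smul_zero, zero_add,
      show a - (q + 2) - 1 = a + 1 - (q + 2 + 2) by omega,
      show (q + 2 + 2) / 2 + 1 = (q + 2) / 2 + 2 by omega]
    simp only [hsgn, show n + (q + 2 + 2) - 1 = n + (q + 2) + 1 by omega,
      show a + 1 - 2 = a - 1 by omega, show q + 2 + 2 - 2 = q + 2 by omega]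
  x_symm i j hi hin hj hjn := h.x_succ_x_comm hi (by omega) hj (by omega)

end IsNormalized

/-! ### Existence of a normalized system -/

section Existence

variable {𝕜 : Type*} [Field 𝕜]

theorem sum_smul_stdVec {n : ℕ} (w : Fin n → 𝕜) (c : ℕ → 𝕜) (hc : ∀ m : Fin n, c (m + 1) = w m) :
    w = ∑ k ∈ Icc 1 n, c k • stdVec 𝕜 n k := by
  ext m
  rw [Finset.sum_apply, sum_eq_single ((m : ℕ) + 1)]
  · simp [stdVec, hc]
  · intro k _ hk
    simp [stdVec, hk.symm]
  · intro h
    exact absurd (mem_Icc.mpr ⟨by omega, by omega⟩) h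

theorem stdVec_succ_eq_basisFun {n : ℕ} (i : Fin n) :
    stdVec 𝕜 n (i + 1) = Pi.basisFun 𝕜 (Fin n) i := by
  ext m
  simp [stdVec, Pi.single_apply, Fin.ext_iff]

theorem stdVec_add_one (n : ℕ) : stdVec 𝕜 n (n + 1) = 0 := by
  ext m
  simp [stdVec, m.2.ne]

theorem filiformBracket_one_left {n j : ℕ} (hj : 2 ≤ j) (hjn : j ≤ n) :
    filiformBracket 𝕜 n (stdVec 𝕜 n 1) (stdVec 𝕜 n j) = -stdVec 𝕜 n (j + 1) := by
  rw [filiformBracket, ofTable_stdVec _ _ _ (mem_Icc.mpr (by omega)) (mem_Icc.mpr (by omega)),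
    if_neg (by omega)]
  rcases eq_or_lt_of_le hjn with rfl | hjn
  · rw [if_neg (by omega), stdVec_add_one, neg_zero]
  · rw [if_pos ⟨rfl, hj, hjn⟩]

theorem filiformBracket_one_right {n j : ℕ} (hj : 2 ≤ j) (hjn : j ≤ n) :
    filiformBracket 𝕜 n (stdVec 𝕜 n j) (stdVec 𝕜 n 1) = stdVec 𝕜 n (j + 1) := by
  rw [filiformBracket, ofTable_stdVec _ _ _ (mem_Icc.mpr (by omega)) (mem_Icc.mpr (by omega))]
  rcases eq_or_lt_of_le hjn with rfl | hjn
  · rw [if_neg (by omega), if_neg (by omega), stdVec_add_one]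
  · rw [if_pos ⟨rfl, hj, hjn⟩]

theorem filiformBracket_one_one {n : ℕ} (hn : 1 ≤ n) :
    filiformBracket 𝕜 n (stdVec 𝕜 n 1) (stdVec 𝕜 n 1) = 0 := by
  rw [filiformBracket, ofTable_stdVec _ _ _ (mem_Icc.mpr (by omega)) (mem_Icc.mpr (by omega)),
    if_neg (by omega), if_neg (by omega)]

theorem filiformBracket_of_two_le {n i j : ℕ} (hi : 2 ≤ i) (hin : i ≤ n) (hj : 2 ≤ j)
    (hjn : j ≤ n) : filiformBracket 𝕜 n (stdVec 𝕜 n i) (stdVec 𝕜 n j) = 0 := by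
  rw [filiformBracket, ofTable_stdVec _ _ _ (mem_Icc.mpr (by omega)) (mem_Icc.mpr (by omega)),
    if_neg (by omega), if_neg (by omega)]

variable {L : Type*} [AddCommGroup L] [Module 𝕜 L]

/-- A basis of a subspace together with lifts of a basis of the quotient is a basis. -/
theorem exists_basis_of_quotient {I : Submodule 𝕜 L} {ι ι' : Type*} (bI : Module.Basis ι 𝕜 I)
    (bQ : Module.Basis ι' 𝕜 (L ⧸ I)) (x : ι' → L)
    (hx : ∀ i, (Submodule.Quotient.mk (x i) : L ⧸ I) = bQ i) :
    ∃ b : Module.Basis (ι' ⊕ ι) 𝕜 L,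
      (∀ i, b (Sum.inl i) = x i) ∧ ∀ i, b (Sum.inr i) = bI i := by
  have hx' : Submodule.Quotient.mk (p := I) ∘ x = bQ := funext hx
  have hli : LinearIndependent 𝕜 (Sum.elim (fun i => (bI i : L)) x) :=
    LinearIndependent.sumElim_of_quotient bI.linearIndependent x
      (by rw [hx']; exact bQ.linearIndependent)
  have hsp : ⊤ ≤ Submodule.span 𝕜 (Set.range (Sum.elim (fun i => (bI i : L)) x)) := by
    rw [Set.Sum.elim_range, Submodule.span_union,
      show Set.range (fun i => (bI i : L)) = I.subtype '' Set.range bI by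
        rw [← Set.range_comp]; rfl,
      ← Submodule.map_span, bI.span_eq, Submodule.map_top, Submodule.range_subtype, top_le_iff,
      ← Submodule.map_mkQ_eq_top, Submodule.map_span, ← Set.range_comp, ← bQ.span_eq, ← hx']
    rfl
  refine ⟨(Module.Basis.mk hli hsp).reindex (Equiv.sumComm ι ι'), fun i => ?_, fun i => ?_⟩ <;>
    simp

variable {μ : L →ₗ[𝕜] L →ₗ[𝕜] L} {n : ℕ}

/-- The construction of a normalized system. The lifts of the first two basis vectors are
corrected by elements `u`, `w` of the ideal; the component of `u` along `e n` is used to remove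
the component of `[x 1, x 2] + [x 2, x 1]` along `e (n - 1)`, that of `w` to remove the one of
`[x 2, x 2]`. -/
theorem exists_isNormalized (hμ : IsLeibniz μ) (hn : 3 ≤ n)
    (φ : (L ⧸ squaresIdeal μ) ≃ₗ[𝕜] (Fin n → 𝕜))
    (hφ : ∀ a b, φ (quotientBracket μ a b) = filiformBracket 𝕜 n (φ a) (φ b))
    (ψ : squaresIdeal μ ≃ₗ[𝕜] (Fin n → 𝕜))
    (hψ : ∀ v a, ψ (idealAction μ hμ v a) = minimalFaithfulAction 𝕜 n (ψ v) (φ a)) :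
    ∃ (x e : ℕ → L) (κ : ℕ → L →ₗ[𝕜] 𝕜) (α : ℕ → 𝕜),
      IsNormalized μ (squaresIdeal μ) n x e κ α ∧
      (∀ j, 1 ≤ j → j ≤ n → φ (Submodule.Quotient.mk (x j)) = stdVec 𝕜 n j) ∧
      ∀ k, e k = ψ.symm (stdVec 𝕜 n k) := by
  have mem_iff (v : L) : v ∈ squaresIdeal μ ↔ φ (Submodule.Quotient.mk v) = 0 := by
    rw [LinearEquiv.map_eq_zero_iff, Submodule.Quotient.mk_eq_zero]
  have φ_mul (y z : L) : φ (Submodule.Quotient.mk (μ y z)) =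
      filiformBracket 𝕜 n (φ (Submodule.Quotient.mk y)) (φ (Submodule.Quotient.mk z)) := by
    rw [← hφ, quotientBracket_mk]
  have mul_right (y : L) : ∀ v ∈ squaresIdeal μ, μ y v = 0 := fun v hv =>
    bracket_squaresIdeal μ hμ y v hv
  have mul_add (a b c d : L) (hd : d ∈ squaresIdeal μ) : μ (a + c) (b + d) = μ a b + μ c b := by
    rw [(μ (a + c)).map_add, mul_right _ d hd, add_zero, map_add, LinearMap.add_apply]
  -- the basis of the ideal and its coordinate functionals
  obtain ⟨e, he⟩ : ∃ e : ℕ → L, ∀ k, e k = ψ.symm (stdVec 𝕜 n k) := ⟨_, fun _ => rfl⟩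
  have e_mem (k : ℕ) : e k ∈ squaresIdeal μ := by rw [he]; exact (ψ.symm _).2
  obtain ⟨g, hg⟩ := LinearMap.exists_extend (ψ : squaresIdeal μ →ₗ[𝕜] (Fin n → 𝕜))
  have hg' (v : L) (hv : v ∈ squaresIdeal μ) : g v = ψ ⟨v, hv⟩ := LinearMap.congr_fun hg ⟨v, hv⟩
  obtain ⟨κ, hκ⟩ : ∃ κ : ℕ → L →ₗ[𝕜] 𝕜, (∀ (m : Fin n) v, κ (m + 1) v = g v m) ∧
      κ 0 = 0 ∧ ∀ k, n < k → κ k = 0 := by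
    refine ⟨fun k => if hk : 1 ≤ k ∧ k ≤ n then
      (LinearMap.proj (⟨k - 1, by omega⟩ : Fin n)).comp g else 0, fun m v => ?_, ?_, ?_⟩
    · beta_reduce
      rw [dif_pos ⟨by omega, by omega⟩]
      rfl
    · simp
    · intro k hk
      exact dif_neg (by omega)
  obtain ⟨hκ, hκ0, hκn⟩ := hκ
  have coord_e (k m : ℕ) (hm : 1 ≤ m) (hmn : m ≤ n) : κ k (e m) = if k = m then 1 else 0 := by
    rcases Nat.eq_zero_or_pos k with rfl | hk
    · rw [hκ0, if_neg (by omega), LinearMap.zero_apply]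
    rcases lt_or_ge n k with hkn | hkn
    · rw [hκn k hkn, if_neg (by omega), LinearMap.zero_apply]
    obtain ⟨k, rfl⟩ : ∃ k', k = k' + 1 := ⟨k - 1, by omega⟩
    rw [hκ ⟨k, hkn⟩, hg' _ (e_mem m)]
    simp [he, stdVec]
  have eq_sum (v : L) (hv : v ∈ squaresIdeal μ) : v = ∑ k ∈ Icc 1 n, κ k v • e k := by
    have h1 := sum_smul_stdVec (ψ ⟨v, hv⟩) (fun k => κ k v) fun m => by rw [hκ, hg' v hv]
    have h2 := congrArg (fun w => ((ψ.symm w : squaresIdeal μ) : L)) h1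
    simpa [he] using h2
  have e_mul (m j : ℕ) (y : L) (hm : 1 ≤ m) (hmn : m ≤ n) (hj : 1 ≤ j) (hjn : j ≤ n)
      (hy : φ (Submodule.Quotient.mk y) = stdVec 𝕜 n j) :
      μ (e m) y = ψ.symm (minimalFaithfulAction 𝕜 n (stdVec 𝕜 n m) (stdVec 𝕜 n j)) := by
    have h1 := hψ (ψ.symm (stdVec 𝕜 n m)) (Submodule.Quotient.mk y)
    rw [LinearEquiv.apply_symm_apply, hy] at h1
    rw [← h1, LinearEquiv.symm_apply_apply, idealAction_mk, he]
  have e_one (m : ℕ) (y : L) (hm : 1 ≤ m) (hmn : m ≤ n)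
      (hy : φ (Submodule.Quotient.mk y) = stdVec 𝕜 n 1) :
      μ (e m) y = if 2 ≤ m ∧ m < n then e (m - 1) else 0 := by
    rw [e_mul m 1 y hm hmn le_rfl (by omega) hy, minimalFaithfulAction,
      ofTable_stdVec _ _ _ (mem_Icc.mpr ⟨hm, hmn⟩) (mem_Icc.mpr (by omega))]
    split_ifs with h1 h2 h3 h3
    · rw [he]
    · omega
    · omega
    · omega
    · omega
    · simp
  have e_two (m j : ℕ) (y : L) (hm : 1 ≤ m) (hmn : m ≤ n) (hj : 2 ≤ j) (hjn : j ≤ n)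
      (hy : φ (Submodule.Quotient.mk y) = stdVec 𝕜 n j) :
      μ (e m) y = if m = n then e (n + 1 - j) else 0 := by
    rw [e_mul m j y hm hmn (by omega) hjn hy, minimalFaithfulAction,
      ofTable_stdVec _ _ _ (mem_Icc.mpr ⟨hm, hmn⟩) (mem_Icc.mpr (by omega)), if_neg (by omega)]
    by_cases h1 : m = n
    · rw [if_pos ⟨h1, hj⟩, if_pos h1, he]
    · rw [if_neg (by omega), if_neg h1]
      simp
  -- elements of the ideal whose product with lifts of `x 1` and `x 2` is prescribed
  have corr (v : L) (hv : v ∈ squaresIdeal μ) (c : 𝕜) : ∃ u ∈ squaresIdeal μ,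
      (∀ y, φ (Submodule.Quotient.mk y) = stdVec 𝕜 n 1 →
        v + μ u y = κ (n - 1) v • e (n - 1) + κ n v • e n) ∧
      ∀ y, φ (Submodule.Quotient.mk y) = stdVec 𝕜 n 2 → μ u y = c • e (n - 1) := by
    refine ⟨c • e n - ∑ k ∈ Icc 1 (n - 2), κ k v • e (k + 1),
      Submodule.sub_mem _ (Submodule.smul_mem _ _ (e_mem _))
        (Submodule.sum_mem _ fun k _ => Submodule.smul_mem _ _ (e_mem _)),
      fun y hy => ?_, fun y hy => ?_⟩
    · have h1 : ∑ k ∈ Icc 1 (n - 2), κ k v • μ (e (k + 1)) y =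
          ∑ k ∈ Icc 1 (n - 2), κ k v • e k := by
        refine sum_congr rfl fun k hk => ?_
        rw [mem_Icc] at hk
        rw [e_one (k + 1) y (by omega) (by omega) hy, if_pos (by omega), Nat.add_sub_cancel]
      have h2 : v = ∑ k ∈ Icc 1 (n - 2), κ k v • e k + κ (n - 1) v • e (n - 1) + κ n v • e n := by
        conv_lhs => rw [eq_sum v hv]
        obtain ⟨m, rfl⟩ : ∃ m, n = m + 2 := ⟨n - 2, by omega⟩
        rw [sum_Icc_succ_top (by omega), sum_Icc_succ_top (by omega)]
        rfl
      rw [map_sub, map_smul, map_sum]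
      simp only [LinearMap.sub_apply, LinearMap.smul_apply, LinearMap.sum_apply, map_smul, h1]
      rw [e_one n y (by omega) le_rfl hy, if_neg (by omega), smul_zero, zero_sub]
      nth_rewrite 1 [h2]
      abel
    · have h1 : ∑ k ∈ Icc 1 (n - 2), κ k v • μ (e (k + 1)) y = 0 := by
        refine sum_eq_zero fun k hk => ?_
        rw [mem_Icc] at hk
        rw [e_two (k + 1) 2 y (by omega) (by omega) le_rfl (by omega) hy, if_neg (by omega),
          smul_zero]
      rw [map_sub, map_smul, map_sum]
      simp only [LinearMap.sub_apply, LinearMap.smul_apply, LinearMap.sum_apply, map_smul, h1]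
      rw [e_two n 2 y (by omega) le_rfl le_rfl (by omega) hy, if_pos rfl, sub_zero,
        show n + 1 - 2 = n - 1 by omega]
  have lift (j : ℕ) : ∃ y : L, φ (Submodule.Quotient.mk y) = stdVec 𝕜 n j := by
    obtain ⟨y, hy⟩ := Submodule.Quotient.mk_surjective (squaresIdeal μ) (φ.symm (stdVec 𝕜 n j))
    exact ⟨y, by rw [hy, LinearEquiv.apply_symm_apply]⟩
  have φ_add (y u : L) (hu : u ∈ squaresIdeal μ) :
      φ (Submodule.Quotient.mk (y + u)) = φ (Submodule.Quotient.mk y) := by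
    rw [Submodule.Quotient.mk_add, map_add, (mem_iff u).mp hu, add_zero]
  obtain ⟨y1, hy1⟩ := lift 1
  obtain ⟨y2, hy2⟩ := lift 2
  have h11 : μ y1 y1 ∈ squaresIdeal μ := by
    rw [mem_iff, φ_mul, hy1, filiformBracket_one_one (by omega)]
  have h12 : μ y1 y2 + μ y2 y1 ∈ squaresIdeal μ := by
    rw [mem_iff, Submodule.Quotient.mk_add, map_add, φ_mul, φ_mul, hy1, hy2,
      filiformBracket_one_left le_rfl (by omega), filiformBracket_one_right le_rfl (by omega),
      neg_add_cancel]
  have h22 : μ y2 y2 ∈ squaresIdeal μ := by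
    rw [mem_iff, φ_mul, hy2, filiformBracket_of_two_le le_rfl (by omega) le_rfl (by omega)]
  obtain ⟨u, hu, hu1, hu2⟩ := corr _ h11 (-κ (n - 1) (μ y1 y2 + μ y2 y1))
  obtain ⟨w, hw, hw1, hw2⟩ := corr _ h12 (-κ (n - 1) (μ y2 y2))
  obtain ⟨x1, hx1⟩ : ∃ z, z = y1 + u := ⟨_, rfl⟩
  obtain ⟨x2, hx2⟩ : ∃ z, z = y2 + w := ⟨_, rfl⟩
  have hφ1 : φ (Submodule.Quotient.mk x1) = stdVec 𝕜 n 1 := by rw [hx1, φ_add _ _ hu, hy1]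
  have hφ2 : φ (Submodule.Quotient.mk x2) = stdVec 𝕜 n 2 := by rw [hx2, φ_add _ _ hw, hy2]
  -- the remaining generators are obtained by multiplying repeatedly with `x 1` from the left
  obtain ⟨x, hxone, hxtwo, hxsucc⟩ : ∃ x : ℕ → L, x 1 = x1 ∧ x 2 = x2 ∧
      ∀ j, 2 ≤ j → x (j + 1) = -μ x1 (x j) := by
    refine ⟨fun j => if j = 1 then x1 else (fun v => -μ x1 v)^[j - 2] x2, if_pos rfl, rfl,
      fun j hj => ?_⟩
    simp only
    rw [if_neg (by omega), if_neg (by omega), show j + 1 - 2 = j - 2 + 1 by omega,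
      Function.iterate_succ_apply']
  have φ_x (j : ℕ) (hj : 2 ≤ j) :
      j ≤ n + 1 → φ (Submodule.Quotient.mk (x j)) = stdVec 𝕜 n j := by
    induction j, hj using Nat.le_induction with
    | base => rw [hxtwo]; exact fun _ => hφ2
    | succ j hj ih =>
      intro hjn
      rw [hxsucc j hj, Submodule.Quotient.mk_neg, map_neg, φ_mul, hφ1, ih (by omega),
        filiformBracket_one_left hj (by omega), neg_neg]
  have φ_x' (j : ℕ) (hj : 1 ≤ j) (hjn : j ≤ n) :
      φ (Submodule.Quotient.mk (x j)) = stdVec 𝕜 n j := by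
    rcases eq_or_lt_of_le hj with rfl | hj
    · rw [hxone, hφ1]
    · exact φ_x j hj (by omega)
  obtain ⟨α, hα1, hα2, hα3, hα4, hα5⟩ : ∃ α : ℕ → 𝕜, α 1 = κ (n - 1) (μ y1 y1) ∧
      α 2 = κ n (μ y1 y1) ∧ α 3 = κ n (μ y1 y2 + μ y2 y1) ∧ α 4 = -κ 1 (x (n + 1)) ∧
      α 5 = κ 1 (μ (x 2) (x n)) :=
    ⟨fun m => match m with
      | 1 => κ (n - 1) (μ y1 y1)
      | 2 => κ n (μ y1 y1)
      | 3 => κ n (μ y1 y2 + μ y2 y1)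
      | 4 => -κ 1 (x (n + 1))
      | _ => κ 1 (μ (x 2) (x n)), rfl, rfl, rfl, rfl, rfl⟩
  refine ⟨x, e, κ, α, ?_, φ_x', he⟩
  exact
    { leibniz := hμ
      mul_right_eq_zero := mul_right
      eq_sum_coord := eq_sum
      coord_e := coord_e
      coord_of_lt := fun k v hk => by rw [hκn k hk, LinearMap.zero_apply]
      e_mem := fun m _ _ => e_mem m
      e_x_one := fun m hm hmn => e_one m _ hm hmn (φ_x' 1 le_rfl (by omega))
      e_x := fun m j hm hmn hj hjn => e_two m j _ hm hmn hj hjn (φ_x' j (by omega) hjn)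
      x_x_mem := fun i j hi hin hj hjn => by
        rw [mem_iff, φ_mul, φ_x' i (by omega) hin, φ_x' j (by omega) hjn,
          filiformBracket_of_two_le hi hin hj hjn]
      x_x_one_sub_mem := fun i hi hin => by
        rw [mem_iff, Submodule.Quotient.mk_sub, map_sub, φ_mul, φ_x' i (by omega) hin,
          φ_x' 1 le_rfl (by omega), φ_x (i + 1) (by omega) (by omega),
          filiformBracket_one_right hi hin, sub_self]
      x_succ := fun j hj => by rw [hxsucc j hj, hxone]
      x_add_one_mem := by
        rw [mem_iff, φ_x (n + 1) (by omega) le_rfl, stdVec_add_one]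
      x_one_x_one := by
        rw [hxone, hα1, hα2, ← hu1 y1 hy1, hx1, mul_add _ _ _ _ hu]
      x_two_x_one := by
        have h1 : μ x1 x2 = μ y1 y2 + μ u y2 := by
          rw [hx1, hx2, mul_add _ _ _ _ hw]
        have h2 : μ x2 x1 = μ y2 y1 + μ w y1 := by
          rw [hx1, hx2, mul_add _ _ _ _ hu]
        have h3 := hw1 y1 hy1
        have h4 := hu2 y2 hy2
        rw [show x 3 = -μ x1 (x 2) from hxsucc 2 le_rfl, hxone, hxtwo, h1, h2, h4, hα3,
          eq_sub_of_add_eq' h3, neg_smul]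
        abel
      coord_x_two_x_two := by
        have h1 : μ x2 x2 = μ y2 y2 + μ w y2 := by
          rw [hx2, mul_add _ _ _ _ hw]
        rw [hxtwo, h1, hw2 y2 hy2, map_add, map_smul, coord_e _ _ (by omega) (by omega),
          if_pos rfl, smul_eq_mul, mul_one, add_neg_cancel]
      alpha_four := hα4
      alpha_five := hα5 }

end Existence

theorem mainTheorem3 {𝕜 L : Type*} [Field 𝕜] [CharZero 𝕜] [AddCommGroup L] [Module 𝕜 L]
    (μ : L →ₗ[𝕜] L →ₗ[𝕜] L) (hμ : IsLeibniz μ) (n : ℕ) (hn : 3 ≤ n)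
    (φ : (L ⧸ squaresIdeal μ) ≃ₗ[𝕜] (Fin n → 𝕜))
    (hφ : ∀ a b, φ (quotientBracket μ a b) = filiformBracket 𝕜 n (φ a) (φ b))
    (ψ : squaresIdeal μ ≃ₗ[𝕜] (Fin n → 𝕜))
    (hψ : ∀ v a, ψ (idealAction μ hμ v a) = minimalFaithfulAction 𝕜 n (ψ v) (φ a)) :
    Module.finrank 𝕜 L = 2 * n ∧
    ∃ (x e : ℕ → L) (b : Module.Basis (Fin n ⊕ Fin n) 𝕜 L)
      (α β : ℕ → 𝕜) (γ : ℕ → ℕ → 𝕜),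
      (∀ i : Fin n, b (Sum.inl i) = x (i + 1) ∧ b (Sum.inr i) = e (i + 1)) ∧
      (∀ i, 1 ≤ i → i ≤ n → e i ∈ squaresIdeal μ) ∧
      HasTable μ n x e α β γ ∧
      (Even n → EvenRestrictions n α γ) ∧
      (Odd n → OddRestrictions n α γ) := by
  obtain ⟨x, e, κ, α, h, hx, he⟩ := exists_isNormalized hμ hn φ hφ ψ hψ
  obtain ⟨b, hb1, hb2⟩ := exists_basis_of_quotient (Module.Basis.ofEquivFun ψ)
    (Module.Basis.ofEquivFun φ) (fun i : Fin n => x (i + 1)) fun i => by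
      rw [← φ.injective.eq_iff, hx _ (by omega) (by omega), stdVec_succ_eq_basisFun]
      simp
  obtain ⟨h1, h2, h3⟩ := h.bracketArray_corner hn
  refine ⟨?_, x, e, b, α, _, _, fun i => ⟨hb1 i, ?_⟩, h.e_mem, h.hasTable hn,
    fun hev => (h.isShiftArray hn).evenRestrictions hn hev h1 h2 h3,
    fun hodd => (h.isShiftArray hn).oddRestrictions hn hodd h2 h3⟩
  · rw [Module.finrank_eq_card_basis b]
    simp [two_mul]
  · rw [hb2, he, stdVec_succ_eq_basisFun]
    simp
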